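/- All Hilbert spaces are complex and $B(\mathcal L)$ denotes the algebra of bounded operators on $\mathcal L$. For a unital $C^*$-algebra $\mathcal A$, a linear map $\phi:\mathcal A\to B(\mathcal L)$ is UCP if it is unital and completely positive. Two linear maps $\phi_j:\mathcal A\to B(\mathcal L_j)$, $j=1,2$, are unitarily equivalent if $\phi_1(a)=U^*\phi_2(a)U$ for all $a\in\mathcal A$, for some unitary $U:\mathcal L_1\to\mathcal L_2$; and $\phi_2$ is a compression of $\phi_1$ if $\phi_2(a)=W^*\phi_1(a)W$ for all $a\in\mathcal A$, for some isometry $W:\mathcal L_2\to\mathcal L_1$. A completely positive map $\phi$ is pure if every completely positive map $\psi$ such that $\phi-\psi$ is completely positive is of the form $\psi=\lambda\phi$ with $\lambda\in[0,1]$. A positive linear map $\phi:B(\mathcal G)\to B(\mathcal L)$ is normal if $\phi(X_\alpha)\to\phi(X)$ in the strong operator topology whenever $(X_\alpha)$ is an increasing or decreasing net of self-adjoint operators with $X_\alpha\to X$ in the strong operator topology. A UCP map $\phi:\mathcal A\to B(\mathcal L)$ is a $C^*$-extreme point of the set $S_{\mathcal L}(\mathcal A)$ of all UCP maps $\mathcal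 A\to B(\mathcal L)$ if, whenever $\phi(a)=\sum_{i=1}^m T_i^*\psi_i(a)T_i$ for all $a\in\mathcal A$, with $\psi_i\in S_{\mathcal L}(\mathcal A)$ and invertible $T_i\in B(\mathcal L)$ satisfying $\sum_{i=1}^m T_i^*T_i=I_{\mathcal L}$, each $\psi_i$ is unitarily equivalent to $\phi$. **Theorem.** Let $\mathcal G$ be a separable Hilbert space, $\mathcal K$ a finite dimensional Hilbert space, and $\mathcal H\subseteq\mathcal G\otimes\mathcal K$ a closed subspace. Let $\phi:B(\mathcal G)\to B(\mathcal H)$ be the normal UCP map $\phi(X)=P_{\mathcal H}(X\otimes I_{\mathcal K})|_{\mathcal H}$, and suppose that this Stinespring form is minimal, that is, that the vectors $(X\otimes I_{\mathcal K})h$ with $X\in B(\mathcal G)$, $h\in\mathcal H$ span a dense subspace of $\mathcal G\otimes\mathcal K$. Then $\phi$ is a $C^*$-extreme point of $S_{\mathcal H}(B(\mathcal G))$ if and only if there are $n\ge 0$, Hilbert spaces $\mathcal H_1,\dots,\mathcal H_n$ and normal pure UCP maps $\phi_i:B(\mathcal G)\to B(\mathcal H_i)$, $1\le i\le n$, such that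 $\phi_i$ is a compression of $\phi_{i+1}$ for $1\le i<n$ and $\phi$ is unitarily equivalent to the direct sum $\bigoplus_{i=1}^n\phi_i:B(\mathcal G)\to B(\bigoplus_{i=1}^n\mathcal H_i)$. (For $n=0$ the direct sum is the map into $B(\{0\})$; this occurs only for $\mathcal H=\{0\}$.) -/

import Mathlib

open scoped TensorProduct Topology

universe u v

noncomputable section

namespace CStarExtreme

section Maps

variable {A : Type*} [CStarAlgebra A] [PartialOrder A] [StarOrderedRing A]
variable {H : Type*} [NormedAddCommGroup H] [InnerProductSpace ℂ H] [CompleteSpace H]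
variable {H₁ : Type*} [NormedAddCommGroup H₁] [InnerProductSpace ℂ H₁] [CompleteSpace H₁]
variable {H₂ : Type*} [NormedAddCommGroup H₂] [InnerProductSpace ℂ H₂] [CompleteSpace H₂]

/-- A linear map `A → B(H)` is completely positive. -/
def IsCP (φ : A →ₗ[ℂ] (H →L[ℂ] H)) : Prop :=
  ∃ Φ : CompletelyPositiveMap A (H →L[ℂ] H), Φ.toLinearMap = φ

/-- A linear map `A → B(H)` is unital and completely positive; these maps form the generalized
state space `S_H(A)`. -/
def IsUCP (φ : A →ₗ[ℂ] (H →L[ℂ] H)) : Prop :=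
  IsCP φ ∧ φ 1 = 1

/-- `φ₁ : A → B(H₁)` and `φ₂ : A → B(H₂)` are unitarily equivalent: `φ₁(a) = U* φ₂(a) U` for a
unitary `U : H₁ → H₂`. -/
def UnitarilyEquivalent (φ₁ : A →ₗ[ℂ] (H₁ →L[ℂ] H₁)) (φ₂ : A →ₗ[ℂ] (H₂ →L[ℂ] H₂)) : Prop :=
  ∃ U : H₁ ≃ₗᵢ[ℂ] H₂, ∀ a : A,
    φ₁ a = ContinuousLinearMap.adjoint (U : H₁ →L[ℂ] H₂) ∘L φ₂ a ∘L (U : H₁ →L[ℂ] H₂)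

/-- `φ₂ : A → B(H₂)` is a compression of `φ₁ : A → B(H₁)`: `φ₂(a) = W* φ₁(a) W` for an isometry
`W : H₂ → H₁`. -/
def IsCompressionOf (φ₂ : A →ₗ[ℂ] (H₂ →L[ℂ] H₂)) (φ₁ : A →ₗ[ℂ] (H₁ →L[ℂ] H₁)) : Prop :=
  ∃ W : H₂ →ₗᵢ[ℂ] H₁, ∀ a : A,
    φ₂ a = ContinuousLinearMap.adjoint W.toContinuousLinearMap ∘L φ₁ a ∘L W.toContinuousLinearMap

/-- A completely positive map `φ` is pure if every completely positive `ψ ≤ φ` (that is, `φ - ψ` is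
completely positive) is `c φ` for some `c ∈ [0, 1]`. -/
def IsPure (φ : A →ₗ[ℂ] (H →L[ℂ] H)) : Prop :=
  IsCP φ ∧ ∀ ψ : A →ₗ[ℂ] (H →L[ℂ] H), IsCP ψ → IsCP (φ - ψ) →
    ∃ c : ℝ, 0 ≤ c ∧ c ≤ 1 ∧ ψ = (c : ℂ) • φ

/-- `φ` is a `C*`-extreme point of `S_H(A)`: it is a UCP map, and whenever
`φ = ∑ i, T i* (ψ i) T i` is a proper `C*`-convex combination (each `ψ i` is a UCP map, each `T i`
is invertible and `∑ i, T i* T i = 1`), every `ψ i` is unitarily equivalent to `φ`. -/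
def IsCStarExtreme (φ : A →ₗ[ℂ] (H →L[ℂ] H)) : Prop :=
  IsUCP φ ∧
    ∀ (n : ℕ) (T : Fin n → (H →L[ℂ] H)) (ψ : Fin n → (A →ₗ[ℂ] (H →L[ℂ] H))),
      (∀ i, IsUCP (ψ i)) → (∀ i, IsUnit (T i)) → ∑ i, star (T i) * T i = 1 →
      (∀ a : A, φ a = ∑ i, star (T i) * ψ i a * T i) →
      ∀ i, UnitarilyEquivalent (ψ i) φ

end Maps

/-- A (positive) linear map `B(G) → B(H)` is normal: it preserves strong operator limits of
increasing or decreasing nets of self-adjoint operators. (Nets indexed by the universe of `G` are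
enough, since a monotone net can be replaced by its range.) -/
def IsNormal {G : Type u} [NormedAddCommGroup G] [InnerProductSpace ℂ G] [CompleteSpace G]
    {H : Type*} [NormedAddCommGroup H] [InnerProductSpace ℂ H]
    (φ : (G →L[ℂ] G) →ₗ[ℂ] (H →L[ℂ] H)) : Prop :=
  ∀ (ι : Type u) [Preorder ι] [IsDirectedOrder ι] [Nonempty ι] (X : ι → (G →L[ℂ] G))
    (X₀ : G →L[ℂ] G),
    (∀ i, IsSelfAdjoint (X i)) → (Monotone X ∨ Antitone X) →
    (∀ g : G, Filter.Tendsto (fun i => X i g) Filter.atTop (𝓝 (X₀ g))) →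
    ∀ h : H, Filter.Tendsto (fun i => φ (X i) h) Filter.atTop (𝓝 (φ X₀ h))

/-- The direct sum `a ↦ ⊕ i, φ i a` of finitely many linear maps `φ i : A → B(H i)`, acting on the
Hilbert space direct sum `PiLp 2 H`. -/
def directSum {A : Type*} [AddCommMonoid A] [Module ℂ A] {n : ℕ} {H : Fin n → Type*}
    [∀ i, NormedAddCommGroup (H i)] [∀ i, InnerProductSpace ℂ (H i)]
    (φ : ∀ i, A →ₗ[ℂ] (H i →L[ℂ] H i)) : A →ₗ[ℂ] (PiLp 2 H →L[ℂ] PiLp 2 H) where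
  toFun a := ((PiLp.continuousLinearEquiv 2 ℂ H).symm : (∀ i, H i) →L[ℂ] PiLp 2 H) ∘L
    (ContinuousLinearMap.pi fun i => φ i a ∘L ContinuousLinearMap.proj i) ∘L
    (PiLp.continuousLinearEquiv 2 ℂ H : PiLp 2 H →L[ℂ] (∀ i, H i))
  map_add' a b := by ext x i; simp
  map_smul' c a := by ext x i; simp

section Tensor

variable {G : Type u} [NormedAddCommGroup G] [InnerProductSpace ℂ G]
variable {K : Type v} [NormedAddCommGroup K] [InnerProductSpace ℂ K]

/-- The map `X ↦ P_H (X ⊗ I_K)|_H` from `B(G)` to `B(H)`, for a closed subspace `H` of `G ⊗ K`. -/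
def compressionMap (H : Submodule ℂ (G ⊗[ℂ] K)) [CompleteSpace H] :
    (G →L[ℂ] G) →ₗ[ℂ] (H →L[ℂ] H) where
  toFun X := H.orthogonalProjectionOnto ∘L X.rTensor K ∘L H.subtypeL
  map_add' X Y := by ext x; simp
  map_smul' c X := by ext x; simp

/-- Minimality of the Stinespring form `X ↦ P_H (X ⊗ I_K)|_H`: the vectors `(X ⊗ I_K) h` with
`X ∈ B(G)` and `h ∈ H` span a dense subspace of `G ⊗ K`. -/
def IsMinimalStinespring (H : Submodule ℂ (G ⊗[ℂ] K)) : Prop :=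
  (Submodule.span ℂ {x : G ⊗[ℂ] K | ∃ X : G →L[ℂ] G, ∃ h ∈ H, x = X.rTensor K h}).topologicalClosure
    = ⊤

/-- If `K` is finite dimensional, the algebraic tensor product `G ⊗ K` is already the Hilbert space
tensor product; so a subspace of it is closed if and only if it is complete. -/
theorem completeSpace_tensor [CompleteSpace G] [FiniteDimensional ℂ K] :
    CompleteSpace (G ⊗[ℂ] K) := by
  let e := stdOrthonormalBasis ℂ K
  let f : PiLp 2 (fun _ : Fin (Module.finrank ℂ K) => G) →ₗ[ℂ] G ⊗[ℂ] K :=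
    { toFun := fun g => ∑ i, g i ⊗ₜ[ℂ] e i
      map_add' := fun g h => by simp [TensorProduct.add_tmul, Finset.sum_add_distrib]
      map_smul' := fun c g => by simp [TensorProduct.smul_tmul', Finset.smul_sum] }
  have hin : ∀ g h, inner ℂ (f g) (f h) = inner ℂ g h := by
    intro g h
    simp [f, sum_inner, inner_sum, PiLp.inner_apply, e.inner_eq_ite]
  let F := f.isometryOfInner hin
  have hs : Function.Surjective F := by
    intro x
    induction x using TensorProduct.induction_on with
    | zero => exact ⟨0, map_zero F⟩
    | add x y hx hy =>
      obtain ⟨a, rfl⟩ := hx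
      obtain ⟨b, rfl⟩ := hy
      exact ⟨a + b, map_add F a b⟩
    | tmul g k =>
      refine ⟨WithLp.toLp 2 fun i => e.repr k i • g, ?_⟩
      change ∑ i, (e.repr k i • g) ⊗ₜ[ℂ] e i = g ⊗ₜ[ℂ] k
      conv_rhs => rw [← e.sum_repr k, TensorProduct.tmul_sum]
      simp [TensorProduct.smul_tmul]
  exact (LinearIsometryEquiv.ofSurjective F hs).toIsometryEquiv.completeSpace_iff.mp inferInstance

end Tensor

end CStarExtreme

end

noncomputable section

namespace CStarExtreme

open scoped ComplexOrder InnerProductSpace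
open ContinuousLinearMap InnerProductSpace

/-! An orthonormal basis of `K` puts `φ` in Kraus form `X ↦ ∑ k, A k* X A k`. By minimality the
slices `(⟪g, A k h⟫)_k` span the multiplicity space `ℂ^d` (unless `G = 0`, when `H = 0` too). Both
sides of the equivalence amount to `φ` being the Kraus map of a nest family (`IsNestFamily`):
partial isometries `V i` with orthogonal initial spaces filling `H` and final spaces increasing in
`i`.

Nest families give the direct sums. The compression of `X` to the final space of `V i` is a normal
pure map, and inclusion of final spaces makes each a compression of the next
(`exists_decomposition`). Conversely, a pure map in Kraus form has a single Kraus operator, and the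
compressions force the ranges to be nested (`exists_isNestFamily`).

Nest families are `C*`-extreme. A completely positive map below `φ` is `X ↦ ∑ D i j V i* X V j` for
a scalar matrix `D` (`exists_matrix_of_dominated`). For a term `T* ψ T` with `T` invertible, `D` is
positive definite, so `D = S* S` with `S` lower triangular. Nestedness lets `S` and its inverse act
on `H`, so `T* ψ T = C* φ C` with `C` invertible, and `ψ` is unitarily equivalent to `φ`.

`C*`-extreme maps come from nest families. Let `M` be the algebra of operators `S` on `ℂ^d` such
that `1 ⊗ S` leaves `H` invariant. For strictly positive `D`, suitably scaled, `φ` splits into the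
maps with weights `D` and `1 - D`. Extremality yields `D = S* S` with `S ∈ M`, and a limit extends
this to all `D ≥ 0` (`hasFactorization_sliceAlgebra`). An algebra with this factorization property
contains every lower triangular operator of some orthonormal basis
(`HasFactorization.exists_triangular_basis`), and the Kraus operators in that basis form a nest
family. -/

theorem inner_self_nonneg_complex {E : Type*} [NormedAddCommGroup E] [InnerProductSpace ℂ E]
    (x : E) : (0 : ℂ) ≤ ⟪x, x⟫_ℂ := by
  rw [inner_self_eq_norm_sq_to_K]
  positivity

theorem operator_nonneg_iff {E : Type*} [NormedAddCommGroup E] [InnerProductSpace ℂ E]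
    (T : E →L[ℂ] E) : 0 ≤ T ↔ ∀ x, 0 ≤ ⟪x, T x⟫_ℂ := by
  rw [nonneg_iff_isPositive]
  refine ⟨fun h x => h.inner_nonneg_right x, fun h => ?_⟩
  rw [isPositive_iff_complex]
  intro x
  have hx := h x
  rw [← inner_conj_symm] at hx
  have hx' : (0 : ℂ) ≤ ⟪T x, x⟫_ℂ := by
    rw [← star_nonneg_iff]
    exact hx
  obtain ⟨h1, h2⟩ := Complex.nonneg_iff.mp hx'
  exact ⟨Complex.ext rfl h2, h1⟩

theorem sum_sum_sum_rotate {ι κ μ M : Type*} [Fintype ι] [Fintype κ] [Fintype μ]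
    [AddCommMonoid M] (f : ι → κ → μ → M) :
    ∑ i, ∑ j, ∑ l, f i j l = ∑ l, ∑ i, ∑ j, f i j l := by
  calc ∑ i, ∑ j, ∑ l, f i j l = ∑ i, ∑ l, ∑ j, f i j l :=
        Finset.sum_congr rfl fun i _ => Finset.sum_comm
    _ = _ := Finset.sum_comm

/-! ### Complete positivity as positivity of the Stinespring form -/

section CompletePositivity

variable {A : Type*} [CStarAlgebra A] [PartialOrder A] [StarOrderedRing A]
variable {H : Type*} [NormedAddCommGroup H] [InnerProductSpace ℂ H] [CompleteSpace H]

theorem sum_inner_star_mul_self {k : ℕ} (N : CStarMatrix (Fin k) (Fin k) (H →L[ℂ] H))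
    (h : Fin k → H) :
    ∑ i, ∑ j, ⟪h i, (star N * N) i j (h j)⟫_ℂ
      = ∑ l, ⟪∑ j, N l j (h j), ∑ j, N l j (h j)⟫_ℂ := by
  have : ∀ i j, (star N * N) i j = ∑ l, adjoint (N l i) ∘L N l j := fun i j => by
    rw [CStarMatrix.mul_apply]
    rfl
  simp only [this, sum_inner, inner_sum, sum_apply, ContinuousLinearMap.comp_apply,
    adjoint_inner_right]
  rw [sum_sum_sum_rotate]
  exact Finset.sum_congr rfl fun l _ => Finset.sum_comm

theorem sum_adjoint_proj {ι : Type*} [Fintype ι] {L : ι → Type*}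
    [∀ i, NormedAddCommGroup (L i)] [∀ i, InnerProductSpace ℂ (L i)] [∀ i, CompleteSpace (L i)]
    (x : PiLp 2 L) :
    ∑ i, adjoint (PiLp.proj (𝕜 := ℂ) 2 L i) (x i) = x := by
  refine ext_inner_left ℂ fun y => ?_
  simp [inner_sum, adjoint_inner_right, PiLp.inner_apply]

theorem proj_adjoint_proj {ι : Type*} [Fintype ι] [DecidableEq ι] {L : ι → Type*}
    [∀ i, NormedAddCommGroup (L i)] [∀ i, InnerProductSpace ℂ (L i)] [∀ i, CompleteSpace (L i)]
    (j : ι) (g : L j) :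
    adjoint (PiLp.proj (𝕜 := ℂ) 2 L j) g = PiLp.single 2 j g := by
  refine ext_inner_right ℂ fun y => ?_
  rw [adjoint_inner_left, PiLp.inner_apply, Finset.sum_eq_single j]
  · simp
  · intro i _ hi
    simp [hi]
  · simp

/-- Compressing a positive operator along a decomposition of the identity yields a positive
operator matrix. -/
theorem cstarMatrix_nonneg_of_decomposition {E : Type*} [NormedAddCommGroup E]
    [InnerProductSpace ℂ E] [CompleteSpace E] {k : ℕ} (P : Fin k → (E →L[ℂ] H))
    (hP : ∀ x, ∑ i, adjoint (P i) (P i x) = x) (S : E →L[ℂ] E) (hS : 0 ≤ S) :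
    0 ≤ (CStarMatrix.ofMatrix fun i j => P i ∘L S ∘L adjoint (P j) :
      CStarMatrix (Fin k) (Fin k) (H →L[ℂ] H)) := by
  obtain ⟨R, rfl⟩ := CStarAlgebra.nonneg_iff_eq_star_mul_self.mp hS
  let N : CStarMatrix (Fin k) (Fin k) (H →L[ℂ] H) :=
    CStarMatrix.ofMatrix fun i j => P i ∘L R ∘L adjoint (P j)
  convert star_mul_self_nonneg N
  refine CStarMatrix.ext fun i j => ?_
  have : (star N * N) i j = ∑ l, adjoint (P l ∘L R ∘L adjoint (P i)) ∘L
      (P l ∘L R ∘L adjoint (P j)) := by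
    rw [CStarMatrix.mul_apply]
    rfl
  rw [this]
  ext h
  change P i (adjoint R (R (adjoint (P j) h))) = _
  simp only [sum_apply, ContinuousLinearMap.comp_apply, adjoint_comp, adjoint_adjoint]
  rw [← map_sum, ← map_sum, hP]

/-- For the converse, the entries are assembled into one positive operator on the direct sum of `k`
copies of `H`, and the matrix is recovered by compressing that operator to the coordinates. -/
theorem cstarMatrix_nonneg_iff {k : ℕ} (T : CStarMatrix (Fin k) (Fin k) (H →L[ℂ] H)) :
    0 ≤ T ↔ ∀ h : Fin k → H, 0 ≤ ∑ i, ∑ j, ⟪h i, T i j (h j)⟫_ℂ := by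
  constructor
  · intro hT h
    rw [StarOrderedRing.nonneg_iff] at hT
    induction hT using AddSubmonoid.closure_induction with
    | mem x hx =>
      obtain ⟨N, rfl⟩ := hx
      rw [sum_inner_star_mul_self]
      exact Finset.sum_nonneg fun l _ => inner_self_nonneg_complex _
    | zero => simp
    | add x y _ _ hx hy =>
      simpa [inner_add_right, Finset.sum_add_distrib] using add_nonneg hx hy
  · intro hT
    let P := fun i => PiLp.proj (𝕜 := ℂ) 2 (fun _ : Fin k => H) i
    let S : PiLp 2 (fun _ : Fin k => H) →L[ℂ] PiLp 2 (fun _ : Fin k => H) :=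
      ∑ i, ∑ j, adjoint (P i) ∘L T i j ∘L P j
    have hS : 0 ≤ S := by
      rw [operator_nonneg_iff]
      intro x
      have : ⟪x, S x⟫_ℂ = ∑ i, ∑ j, ⟪P i x, T i j (P j x)⟫_ℂ := by
        simp [S, sum_apply, adjoint_inner_right]
      exact this ▸ hT fun i => P i x
    convert cstarMatrix_nonneg_of_decomposition P sum_adjoint_proj S hS
    refine CStarMatrix.ext fun i j => ?_
    ext h
    change _ = P i (S (adjoint (P j) h))
    have hP : ∀ a, P a (adjoint (P j) h) = if a = j then h else 0 := fun a => by
      simp only [P, proj_adjoint_proj]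
      by_cases ha : a = j
      · subst ha
        simp
      · simp [ha]
    have hP' : ∀ g, P i (adjoint (P i) g) = g := fun g => by
      simp [P, proj_adjoint_proj]
    have hP'' : ∀ a, a ≠ i → ∀ g, P i (adjoint (P a) g) = 0 := fun a ha g => by
      simp [P, proj_adjoint_proj, ha.symm]
    simp only [S, sum_apply, ContinuousLinearMap.comp_apply, hP, map_sum]
    rw [Finset.sum_eq_single i, Finset.sum_eq_single j]
    · simp [hP']
    · intro b _ hb
      simp [hb]
    · simp
    · intro a _ ha
      exact Finset.sum_eq_zero fun b _ => hP'' a ha _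
    · simp

/-- Complete positivity in terms of the sesquilinear form of the Stinespring construction. -/
theorem isCP_iff (φ : A →ₗ[ℂ] (H →L[ℂ] H)) :
    IsCP φ ↔ ∀ (k : ℕ) (a : Fin k → A) (h : Fin k → H),
      0 ≤ ∑ i, ∑ j, ⟪h i, φ (star (a i) * a j) (h j)⟫_ℂ := by
  constructor
  · rintro ⟨Φ, rfl⟩ k a h
    rcases k with _ | k
    · simp
    -- The matrix with first row `a` and zeros elsewhere, so that `N* N` has entries `a i* a j`.
    let N : CStarMatrix (Fin (k + 1)) (Fin (k + 1)) A :=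
      CStarMatrix.ofMatrix fun i j => if i = 0 then a j else 0
    have hN : ∀ i j, (star N * N) i j = star (a i) * a j := by
      intro i j
      rw [CStarMatrix.mul_apply, Finset.sum_eq_single 0]
      · rfl
      · intro l _ hl
        rw [show N l j = 0 from if_neg hl, mul_zero]
      · simp
    have := (cstarMatrix_nonneg_iff _).mp
      (Φ.map_cstarMatrix_nonneg' (k + 1) (star N * N) (star_mul_self_nonneg N)) h
    simpa only [CStarMatrix.map_apply, hN] using this
  · intro hφ
    refine ⟨⟨φ, fun k M hM => ?_⟩, rfl⟩
    rw [cstarMatrix_nonneg_iff]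
    intro h
    rw [StarOrderedRing.nonneg_iff] at hM
    induction hM using AddSubmonoid.closure_induction with
    | mem x hx =>
      obtain ⟨N, rfl⟩ := hx
      have : ∑ i, ∑ j, ⟪h i, (star N * N).map φ i j (h j)⟫_ℂ
          = ∑ l, ∑ i, ∑ j, ⟪h i, φ (star (N l i) * N l j) (h j)⟫_ℂ := by
        simp only [CStarMatrix.map_apply, CStarMatrix.mul_apply, CStarMatrix.star_apply, map_sum,
          inner_sum, sum_apply]
        exact sum_sum_sum_rotate _
      exact this ▸ Finset.sum_nonneg fun l _ => hφ k (N l) h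
    | zero => simp
    | add x y _ _ hx hy =>
      simpa [inner_add_right, Finset.sum_add_distrib] using add_nonneg hx hy

end CompletePositivity

section CPConsequences

variable {A : Type*} [CStarAlgebra A] [PartialOrder A] [StarOrderedRing A]
variable {H : Type*} [NormedAddCommGroup H] [InnerProductSpace ℂ H] [CompleteSpace H]

theorem IsCP.map_star {φ : A →ₗ[ℂ] (H →L[ℂ] H)} (hφ : IsCP φ) (a : A) :
    φ (star a) = adjoint (φ a) := by
  obtain ⟨Φ, rfl⟩ := hφ
  exact StarHomClass.map_star Φ a

theorem IsCP.map_one_nonneg {φ : A →ₗ[ℂ] (H →L[ℂ] H)} (hφ : IsCP φ) : 0 ≤ φ 1 := by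
  rw [operator_nonneg_iff]
  intro x
  simpa using (isCP_iff φ).mp hφ 1 (fun _ => 1) (fun _ => x)

theorem IsCP.add {φ ψ : A →ₗ[ℂ] (H →L[ℂ] H)} (hφ : IsCP φ) (hψ : IsCP ψ) : IsCP (φ + ψ) := by
  rw [isCP_iff] at *
  intro k a h
  simpa [inner_add_right, Finset.sum_add_distrib] using add_nonneg (hφ k a h) (hψ k a h)

theorem IsCP.sum {ι : Type*} (s : Finset ι) {φ : ι → A →ₗ[ℂ] (H →L[ℂ] H)}
    (hφ : ∀ i ∈ s, IsCP (φ i)) : IsCP (∑ i ∈ s, φ i) := by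
  classical
  induction s using Finset.induction_on with
  | empty =>
    rw [isCP_iff]
    simp
  | insert i s hi ih =>
    rw [Finset.sum_insert hi]
    exact (hφ i (by simp)).add (ih fun j hj => hφ j (by simp [hj]))

/-- The map `a ↦ T* ψ(a) T`. -/
def conjMap (T : H →L[ℂ] H) (ψ : A →ₗ[ℂ] (H →L[ℂ] H)) : A →ₗ[ℂ] (H →L[ℂ] H) where
  toFun a := star T * ψ a * T
  map_add' a b := by simp [mul_add, add_mul]
  map_smul' c a := by simp

omit [PartialOrder A] [StarOrderedRing A] in
theorem conjMap_apply (T : H →L[ℂ] H) (ψ : A →ₗ[ℂ] (H →L[ℂ] H)) (a : A) :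
    conjMap T ψ a = star T * ψ a * T := rfl

theorem IsCP.conjMap {ψ : A →ₗ[ℂ] (H →L[ℂ] H)} (hψ : IsCP ψ) (T : H →L[ℂ] H) :
    IsCP (conjMap T ψ) := by
  rw [isCP_iff] at *
  intro k a h
  have : ∀ i j, ⟪h i, CStarExtreme.conjMap T ψ (star (a i) * a j) (h j)⟫_ℂ
      = ⟪T (h i), ψ (star (a i) * a j) (T (h j))⟫_ℂ := fun i j => by
    rw [← adjoint_inner_right]
    rfl
  simpa only [this] using hψ k a fun i => T (h i)

end CPConsequences

/-! ### Kraus maps and the completely positive maps they dominate -/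

section Kraus

variable {G : Type*} [NormedAddCommGroup G] [InnerProductSpace ℂ G] [CompleteSpace G]
variable {H : Type*} [NormedAddCommGroup H] [InnerProductSpace ℂ H] [CompleteSpace H]
variable {ι : Type*} [Fintype ι]

/-- The map `X ↦ ∑ i, (V i)* X (V i)`. -/
def krausMap (V : ι → (H →L[ℂ] G)) : (G →L[ℂ] G) →ₗ[ℂ] (H →L[ℂ] H) where
  toFun X := ∑ i, adjoint (V i) ∘L X ∘L V i
  map_add' X Y := by simp [Finset.sum_add_distrib]
  map_smul' c X := by simp [Finset.smul_sum]

theorem krausMap_apply (V : ι → (H →L[ℂ] G)) (X : G →L[ℂ] G) :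
    krausMap V X = ∑ i, adjoint (V i) ∘L X ∘L V i := rfl

theorem inner_krausMap (V : ι → (H →L[ℂ] G)) (X : G →L[ℂ] G) (x y : H) :
    ⟪x, krausMap V X y⟫_ℂ = ∑ i, ⟪V i x, X (V i y)⟫_ℂ := by
  simp [krausMap_apply, sum_apply, adjoint_inner_right]

theorem sum_inner_krausMap (V : ι → (H →L[ℂ] G)) {k : ℕ} (a : Fin k → (G →L[ℂ] G))
    (h : Fin k → H) :
    ∑ i, ∑ j, ⟪h i, krausMap V (star (a i) * a j) (h j)⟫_ℂ
      = ∑ l, ⟪∑ j, a j (V l (h j)), ∑ j, a j (V l (h j))⟫_ℂ := by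
  simp only [inner_krausMap, sum_inner, inner_sum]
  rw [sum_sum_sum_rotate]
  refine Finset.sum_congr rfl fun l _ => ?_
  rw [Finset.sum_comm]
  refine Finset.sum_congr rfl fun i _ => Finset.sum_congr rfl fun j _ => ?_
  rw [mul_apply_eq_comp, star_eq_adjoint, adjoint_inner_right]

theorem isCP_krausMap (V : ι → (H →L[ℂ] G)) : IsCP (krausMap V) := by
  rw [isCP_iff]
  intro k a h
  rw [sum_inner_krausMap]
  exact Finset.sum_nonneg fun l _ => inner_self_nonneg_complex _

/-- A completely positive map dominated by `X ↦ ∑ i, (V i)* X (V i)` only depends on the vectors of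
the Stinespring space. -/
theorem apply_eq_of_dominated (V : ι → (H →L[ℂ] G)) {ψ : (G →L[ℂ] G) →ₗ[ℂ] (H →L[ℂ] H)}
    (hψ : IsCP ψ) (hφψ : IsCP (krausMap V - ψ)) {a b : G →L[ℂ] G} {x y : H}
    (hab : ∀ i, a (V i x) = b (V i y)) : ψ a x = ψ b y := by
  set w := ψ a x - ψ b y with hw
  have h1 := (isCP_iff _).mp hψ
  have h2 := (isCP_iff _).mp hφψ 2 ![a, b] ![x, -y]
  have h3 := sum_inner_krausMap V ![a, b] ![x, -y]
  simp only [Fin.sum_univ_two, Matrix.cons_val_zero, Matrix.cons_val_one, map_neg, hab,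
    add_neg_cancel, inner_zero_left, Finset.sum_const_zero] at h3
  have h4 := h1 2 ![a, b] ![x, -y]
  set e := ∑ i, ∑ j, ⟪(![x, -y] : Fin 2 → H) i, ψ (star ((![a, b] : Fin 2 → _) i) *
    (![a, b] : Fin 2 → _) j) ((![x, -y] : Fin 2 → H) j)⟫_ℂ with he
  -- The Stinespring vector `a ⊗ x - b ⊗ y` is null for `krausMap V`, hence null for the smaller
  -- form of `ψ`.
  have he0 : e = 0 := by
    refine le_antisymm ?_ h4
    have : (0 : ℂ) ≤ 0 - e := by
      convert h2 using 1
      simp only [LinearMap.sub_apply, sub_apply, inner_sub_right,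
        Finset.sum_sub_distrib, he]
      congr 1
      simpa [Fin.sum_univ_two] using h3.symm
    simpa using this
  -- Cauchy–Schwarz by hand: the form of `ψ` at `a ⊗ x - b ⊗ y - s (1 ⊗ w)`. Its quadratic term is
  -- bounded and its constant term vanishes, so the linear coefficient must vanish.
  have h5 : ∀ s : ℝ, (0 : ℂ) ≤ - 2 * s * ⟪w, w⟫_ℂ + s ^ 2 * ⟪w, ψ 1 w⟫_ℂ := by
    intro s
    have := h1 3 ![a, b, 1] ![x, -y, -(s : ℂ) • w]
    convert this using 1
    rw [← zero_add (_ + _), ← he0, he]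
    simp [Fin.sum_univ_three, Fin.sum_univ_two, hψ.map_star, adjoint_inner_right, inner_neg_left, inner_neg_right]
    have e1 : ⟪ψ a x, w⟫_ℂ - ⟪ψ b y, w⟫_ℂ = ⟪w, w⟫_ℂ := by rw [hw, inner_sub_left]
    have e2 : ⟪w, ψ a x⟫_ℂ - ⟪w, ψ b y⟫_ℂ = ⟪w, w⟫_ℂ := by rw [hw, inner_sub_right]
    have e3 : ⟪ψ 1 w, w⟫_ℂ = ⟪w, ψ 1 w⟫_ℂ := by
      rw [← adjoint_inner_right, ← hψ.map_star, star_one]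
    have e4 : ((‖w‖ : ℂ)) ^ 2 = ⟪w, w⟫_ℂ := by
      rw [inner_self_eq_norm_sq_to_K]; simp
    linear_combination (s : ℂ) * e1 + (s : ℂ) * e2 - (s : ℂ) ^ 2 * e3 - 2 * s * e4
  have h6 : 0 ≤ ⟪w, ψ 1 w⟫_ℂ := by
    simpa using h1 1 (fun _ => 1) (fun _ => w)
  obtain ⟨c, hc⟩ : ∃ c : ℝ, ⟪w, ψ 1 w⟫_ℂ = c := ⟨_, Complex.eq_re_of_ofReal_le h6⟩
  rw [hc] at h6 h5
  have hww : ⟪w, w⟫_ℂ = ((‖w‖ ^ 2 : ℝ) : ℂ) := by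
    rw [inner_self_eq_norm_sq_to_K]; simp
  have h7 : ∀ s : ℝ, 0 ≤ - 2 * s * ‖w‖ ^ 2 + s ^ 2 * c := by
    intro s
    have := h5 s
    rw [hww] at this
    exact_mod_cast this
  have hc0 : 0 ≤ c := by exact_mod_cast h6
  have h8 : ‖w‖ ^ 2 ≤ 0 := by
    have h9 := h7 (‖w‖ ^ 2 / (c + 1))
    have hc1 : 0 < c + 1 := by linarith
    have e : - 2 * (‖w‖ ^ 2 / (c + 1)) * ‖w‖ ^ 2 + (‖w‖ ^ 2 / (c + 1)) ^ 2 * c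
        = - ((‖w‖ ^ 2) ^ 2 * (c + 2) / (c + 1) ^ 2) := by field_simp; ring
    by_contra! hw0
    have : 0 < (‖w‖ ^ 2) ^ 2 * (c + 2) / (c + 1) ^ 2 := by positivity
    linarith
  have : w = 0 := by
    rw [← norm_eq_zero]
    exact pow_eq_zero_iff two_ne_zero |>.mp (le_antisymm h8 (by positivity))
  exact sub_eq_zero.mp (hw ▸ this)

end Kraus

/-! ### Triangular factorization of positive definite matrices -/

section Triangular

variable {ι : Type*} [Fintype ι] [LinearOrder ι]

/-- Cholesky decomposition `D = S* S` with `S` lower triangular. -/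
theorem exists_lower_factor {D : Matrix ι ι ℂ} (hD : D.PosDef) :
    ∃ S R : Matrix ι ι ℂ, (∀ i j, i < j → S i j = 0) ∧ (∀ i j, i < j → R i j = 0) ∧
      S * R = 1 ∧ R * S = 1 ∧ S.conjTranspose * S = D := by
  classical
  let : LocallyFiniteOrderBot ι := LocallyFiniteOrderBot.ofIic ι
    (fun a => Finset.univ.filter (· ≤ a)) (by simp)
  -- Decomposing `D` itself would put the lower factor on the left. From `N D⁻¹ N* = diag δ` one
  -- gets `D = S* S` with `S = δ^(-1/2) N` lower triangular.
  have hE := hD.inv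
  have hEN := LDL.diag_eq_lowerInv_conj hE
  have hNtri : ∀ i j, i < j → LDL.lowerInv hE i j = 0 :=
    fun i j hij => LDL.lowerInv_triangular hE hij
  have hNu : IsUnit (LDL.lowerInv hE) := isUnit_of_invertible _
  generalize LDL.lowerInv hE = N at *
  rw [LDL.diag] at hEN
  generalize LDL.diagEntries hE = δ at *
  have hδ : ∀ i, 0 < δ i := by
    rw [← Matrix.posDef_diagonal_iff, hEN]
    exact (Matrix.IsUnit.posDef_star_right_conjugate_iff hNu).mpr hE
  let ε : ι → ℂ := fun i => ((Real.sqrt (δ i).re)⁻¹ : ℝ)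
  have hε : ∀ i, ε i * δ i * ε i = 1 := by
    intro i
    obtain ⟨h1, h2⟩ := Complex.pos_iff.mp (hδ i)
    have h3 : δ i = ((δ i).re : ℂ) := Complex.ext rfl (by simp [← h2])
    have h4 : (Real.sqrt (δ i).re)⁻¹ * (δ i).re * (Real.sqrt (δ i).re)⁻¹ = 1 := by
      have h5 := Real.mul_self_sqrt h1.le
      have h6 : Real.sqrt (δ i).re ≠ 0 := (Real.sqrt_pos.mpr h1).ne'
      field_simp
      rw [sq, h5]
    simp only [ε]
    conv_lhs => rw [h3]
    exact_mod_cast h4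
  have hεs : star ε = ε := by
    ext i
    simp [ε]
  let S := Matrix.diagonal ε * N
  have hS : ∀ i j, i < j → S i j = 0 := by
    intro i j hij
    simp [S, Matrix.diagonal_mul, hNtri i j hij]
  have h1 : S * (D⁻¹ * S.conjTranspose) = 1 := by
    simp only [S, Matrix.conjTranspose_mul, Matrix.diagonal_conjTranspose, hεs]
    calc _ = Matrix.diagonal ε * (N * D⁻¹ * N.conjTranspose) * Matrix.diagonal ε := by
          simp only [Matrix.mul_assoc]
      _ = 1 := by
          rw [← hEN, Matrix.diagonal_mul_diagonal, Matrix.diagonal_mul_diagonal,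
            ← Matrix.diagonal_one]
          exact congrArg _ (funext hε)
  have h2 := mul_eq_one_comm.mp h1
  refine ⟨S, D⁻¹ * S.conjTranspose, hS, ?_, h1, h2, ?_⟩
  · have : Invertible S := ⟨_, h2, h1⟩
    rw [← Matrix.inv_eq_right_inv h1]
    have := Matrix.blockTriangular_inv_of_blockTriangular (M := S) (b := OrderDual.toDual)
      fun i j hij => hS i j hij
    exact fun i j hij => this hij
  · have hDu : IsUnit D.det := hD.det_pos.ne'.isUnit
    calc S.conjTranspose * S = D * (D⁻¹ * S.conjTranspose * S) := by
          rw [Matrix.mul_assoc D⁻¹, Matrix.mul_nonsing_inv_cancel_left _ _ hDu]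
      _ = D := by rw [h2, Matrix.mul_one]

end Triangular

section Unitary

variable {A : Type*} [CStarAlgebra A] [PartialOrder A] [StarOrderedRing A]
variable {H : Type*} [NormedAddCommGroup H] [InnerProductSpace ℂ H] [CompleteSpace H]

omit [PartialOrder A] [StarOrderedRing A] in
-- The operator `u = C T⁻¹` conjugates `φ` into `ψ`. Since both maps are unital, `u* u = 1`, and an
-- invertible isometry is unitary.
theorem unitarilyEquivalent_of_conj {φ ψ : A →ₗ[ℂ] (H →L[ℂ] H)} (hψ : ψ 1 = 1) (hφ : φ 1 = 1)
    {T C : H →L[ℂ] H} (hT : IsUnit T) (hC : IsUnit C)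
    (h : ∀ a, star T * ψ a * T = star C * φ a * C) : UnitarilyEquivalent ψ φ := by
  obtain ⟨t, rfl⟩ := hT
  obtain ⟨c, rfl⟩ := hC
  set u : (H →L[ℂ] H)ˣ := c * t⁻¹ with hu
  have h1 : ∀ a, ψ a = star (u : H →L[ℂ] H) * φ a * u := by
    intro a
    have h2 : star (↑t⁻¹ : H →L[ℂ] H) * star (t : H →L[ℂ] H) = 1 := by
      rw [← star_mul, Units.mul_inv, star_one]
    calc ψ a = (star (↑t⁻¹ : H →L[ℂ] H) * star (t : H →L[ℂ] H)) * ψ a * (t * ↑t⁻¹) := by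
          rw [h2, Units.mul_inv, one_mul, mul_one]
      _ = star (↑t⁻¹ : H →L[ℂ] H) * (star (t : H →L[ℂ] H) * ψ a * t) * ↑t⁻¹ := by
          simp only [mul_assoc]
      _ = _ := by
          rw [h, hu]
          simp only [Units.val_mul, star_mul, mul_assoc]
  have h3 : star (u : H →L[ℂ] H) * u = 1 := by
    rw [← hψ, h1, hφ, mul_one]
  have h4 : (u : H →L[ℂ] H) * star (u : H →L[ℂ] H) = 1 := by
    rw [← Units.inv_eq_of_mul_eq_one_left h3, Units.mul_inv]
  refine ⟨Unitary.linearIsometryEquiv ⟨u, h3, h4⟩, fun a => ?_⟩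
  rw [Unitary.coe_linearIsometryEquiv_apply, h1]
  rfl

end Unitary

/-! ### Nest families give `C*`-extreme points -/

section NestFamily

variable {G : Type*} [NormedAddCommGroup G] [InnerProductSpace ℂ G] [CompleteSpace G]
variable {H : Type*} [NormedAddCommGroup H] [InnerProductSpace ℂ H] [CompleteSpace H]
variable {ι : Type*} [Fintype ι] [LinearOrder ι]

/-- A decomposition of `H` into pieces which are identified with an increasing family of closed
subspaces of `G` by partial isometries `V i`. -/
structure IsNestFamily (V : ι → (H →L[ℂ] G)) : Prop where
  sum_adjoint_comp : ∑ i, adjoint (V i) ∘L V i = 1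
  comp_adjoint_of_ne : ∀ i j, i ≠ j → V i ∘L adjoint (V j) = 0
  comp_adjoint_comp : ∀ i j, i ≤ j → V j ∘L adjoint (V j) ∘L V i = V i

namespace IsNestFamily

variable {V : ι → (H →L[ℂ] G)}

theorem restrict (hV : IsNestFamily V) [DecidablePred fun i => V i ≠ 0] :
    IsNestFamily (fun i : {i // V i ≠ 0} => V i) where
  sum_adjoint_comp := by
    rw [← hV.sum_adjoint_comp, ← Finset.sum_subtype (Finset.univ.filter fun i => V i ≠ 0) (by simp)
      fun i => adjoint (V i) ∘L V i]
    refine Finset.sum_subset (Finset.subset_univ _) fun i _ hi => ?_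
    simp [show V i = 0 by simpa using hi]
  comp_adjoint_of_ne i j hij := hV.comp_adjoint_of_ne i j fun h => hij (Subtype.ext h)
  comp_adjoint_comp i j hij := hV.comp_adjoint_comp i j hij

theorem apply_adjoint_of_ne (hV : IsNestFamily V) {i j : ι} (hij : i ≠ j) (g : G) :
    V i (adjoint (V j) g) = 0 :=
  DFunLike.congr_fun (hV.comp_adjoint_of_ne i j hij) g

theorem apply_adjoint_apply (hV : IsNestFamily V) {i j : ι} (hij : i ≤ j) (h : H) :
    V j (adjoint (V j) (V i h)) = V i h :=
  DFunLike.congr_fun (hV.comp_adjoint_comp i j hij) h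

theorem sum_apply_apply (hV : IsNestFamily V) (h : H) : ∑ i, adjoint (V i) (V i h) = h := by
  have := DFunLike.congr_fun hV.sum_adjoint_comp h
  simpa [sum_apply] using this

/-- Any unit vector in the smallest final space lies in all of them. It serves as a reference vector
from which scalar weights are read off. -/
theorem exists_common_vector (hV : IsNestFamily V) [Nonempty ι] (h0 : ∀ i, V i ≠ 0) :
    ∃ g : G, ‖g‖ = 1 ∧ ∀ i, V i (adjoint (V i) g) = g := by
  obtain ⟨i₀, hi₀ : ∀ i, i₀ ≤ i⟩ := Finite.exists_min (id : ι → ι)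
  obtain ⟨x, hx⟩ := DFunLike.ne_iff.mp (h0 i₀)
  refine ⟨((‖V i₀ x‖⁻¹ : ℝ) : ℂ) • V i₀ x, ?_, fun i => ?_⟩
  · have : ‖V i₀ x‖ ≠ 0 := norm_ne_zero_iff.mpr hx
    rw [norm_smul, Complex.norm_real, norm_inv, norm_norm, inv_mul_cancel₀ this]
  · rw [map_smul, map_smul, hV.apply_adjoint_apply (hi₀ i)]

/-- The Radon-Nikodym derivative of a completely positive map dominated by
`X ↦ ∑ i, (V i)* X (V i)`. -/
theorem exists_matrix_of_dominated (hV : IsNestFamily V) {g : G} (hg : ‖g‖ = 1)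
    (hVg : ∀ i, V i (adjoint (V i) g) = g) {ψ : (G →L[ℂ] G) →ₗ[ℂ] (H →L[ℂ] H)}
    (hψ : IsCP ψ) (hφψ : IsCP (krausMap V - ψ)) :
    ∃ D : Matrix ι ι ℂ, D.IsHermitian ∧
      ∀ X, ψ X = ∑ i, ∑ j, D i j • (adjoint (V i) ∘L X ∘L V j) := by
  have hgg : ⟪g, g⟫_ℂ = 1 := by
    rw [inner_self_eq_norm_sq_to_K, hg]; simp
  let η : ι → H := fun i => adjoint (V i) g
  -- The rank one operator sends `g = V j (η j)` to `X (V j h)`, so both sides come from the same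
  -- Stinespring vector. Thus `ψ` is determined by its values on rank one operators at the vectors
  -- `η j`.
  have key : ∀ (X : G →L[ℂ] G) (j : ι) (h : H),
      ψ X (adjoint (V j) (V j h)) = ψ (rankOne ℂ (X (V j h)) g) (η j) := by
    intro X j h
    refine apply_eq_of_dominated V hψ hφψ fun i => ?_
    by_cases hij : i = j
    · subst hij
      simp only [η, hV.apply_adjoint_apply le_rfl, hVg, rankOne_apply, hgg, one_smul]
    · simp [η, hV.apply_adjoint_of_ne hij]
  have hadj : ∀ (X : G →L[ℂ] G) (x y : H), ⟪x, ψ X y⟫_ℂ = ⟪ψ (adjoint X) x, y⟫_ℂ := by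
    intro X x y
    rw [← star_eq_adjoint, hψ.map_star, adjoint_inner_left]
  let D : Matrix ι ι ℂ := fun i j => ⟪η i, ψ (rankOne ℂ g g) (η j)⟫_ℂ
  refine ⟨D, ?_, fun X => ?_⟩
  · ext i j
    rw [Matrix.conjTranspose_apply]
    simp only [D]
    rw [hadj, adjoint_rankOne]
    exact inner_conj_symm _ _
  · have key2 : ∀ i j f h, ⟪adjoint (V i) (V i f), ψ X (adjoint (V j) (V j h))⟫_ℂ
        = D i j * ⟪V i f, X (V j h)⟫_ℂ := by
      intro i j f h
      have h1 : ψ (rankOne ℂ g (X (V j h))) (adjoint (V i) (V i f))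
          = ⟪X (V j h), V i f⟫_ℂ • ψ (rankOne ℂ g g) (η i) := by
        rw [key, rankOne_apply, map_smul, smul_apply, map_smul, smul_apply]
      rw [key, hadj, adjoint_rankOne, h1, inner_smul_left, inner_conj_symm, mul_comm]
      congr 1
      simp only [D]
      rw [hadj, adjoint_rankOne]
    ext h
    refine ext_inner_left ℂ fun f => ?_
    conv_lhs => rw [← hV.sum_apply_apply f, ← hV.sum_apply_apply h]
    simp only [map_sum, sum_inner, inner_sum, key2, sum_apply, smul_apply, inner_smul_right,
      ContinuousLinearMap.comp_apply, adjoint_inner_right]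
    exact Finset.sum_comm

/-- The operator on `H` with matrix `S`. -/
def _root_.CStarExtreme.blockOp (V : ι → (H →L[ℂ] G)) (S : Matrix ι ι ℂ) : H →L[ℂ] H :=
  ∑ i, ∑ j, S i j • (adjoint (V i) ∘L V j)

theorem apply_blockOp (hV : IsNestFamily V) {S : Matrix ι ι ℂ} (hS : ∀ i j, i < j → S i j = 0)
    (k : ι) (h : H) : V k (blockOp V S h) = ∑ j, S k j • V j h := by
  simp only [blockOp, sum_apply, smul_apply, map_sum, map_smul, ContinuousLinearMap.comp_apply]
  rw [Finset.sum_eq_single k]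
  · refine Finset.sum_congr rfl fun j _ => ?_
    -- The final space of `V k` contains that of `V j` only for `j ≤ k`; triangularity kills the
    -- other terms.
    rcases le_or_gt j k with hjk | hjk
    · rw [hV.apply_adjoint_apply hjk]
    · rw [hS k j hjk, zero_smul, zero_smul]
  · intro i _ hi
    simp [hV.apply_adjoint_of_ne hi.symm]
  · simp

theorem blockOp_mul (hV : IsNestFamily V) {S R : Matrix ι ι ℂ} (hR : ∀ i j, i < j → R i j = 0) :
    blockOp V S * blockOp V R = blockOp V (S * R) := by
  ext h
  rw [mul_apply_eq_comp]
  conv_lhs => rw [blockOp]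
  simp only [sum_apply, smul_apply, ContinuousLinearMap.comp_apply, hV.apply_blockOp hR]
  simp only [blockOp, sum_apply, smul_apply, ContinuousLinearMap.comp_apply, Matrix.mul_apply,
    map_sum, map_smul, Finset.smul_sum, Finset.sum_smul, smul_smul]
  exact Finset.sum_congr rfl fun i _ => Finset.sum_comm

theorem blockOp_one (hV : IsNestFamily V) : blockOp V (1 : Matrix ι ι ℂ) = 1 := by
  rw [← hV.sum_adjoint_comp, blockOp]
  refine Finset.sum_congr rfl fun i _ => ?_
  rw [Finset.sum_eq_single i]
  · simp
  · intro j _ hj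
    simp [Matrix.one_apply_ne hj.symm]
  · simp

/-- Composing `V k` with the block operator gives `∑ j, S k j • V j`; expanding the Kraus sum of
these operators produces the weights `S* S`. -/
theorem conj_blockOp (hV : IsNestFamily V) {S : Matrix ι ι ℂ} (hS : ∀ i j, i < j → S i j = 0)
    (X : G →L[ℂ] G) :
    star (blockOp V S) * krausMap V X * blockOp V S
      = ∑ i, ∑ j, (S.conjTranspose * S) i j • (adjoint (V i) ∘L X ∘L V j) := by
  ext h
  refine ext_inner_left ℂ fun f => ?_
  have : (star (blockOp V S) * krausMap V X * blockOp V S) h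
    = adjoint (blockOp V S) (krausMap V X (blockOp V S h)) := rfl
  rw [this, adjoint_inner_right, inner_krausMap]
  simp only [hV.apply_blockOp hS, sum_apply, smul_apply, inner_smul_right, inner_sum, sum_inner,
    inner_smul_left, map_sum, map_smul, Matrix.mul_apply, Matrix.conjTranspose_apply,
    ContinuousLinearMap.comp_apply, adjoint_inner_right, Finset.sum_mul, Finset.mul_sum]
  refine (Finset.sum_congr rfl fun k _ => Finset.sum_comm).trans ?_
  rw [← sum_sum_sum_rotate]
  refine Finset.sum_congr rfl fun i _ => Finset.sum_congr rfl fun j _ =>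
    Finset.sum_congr rfl fun k _ => ?_
  rw [starRingEnd_apply]
  ring

/-- The vector `ξ = ∑ x i • V i* g` satisfies `V i ξ = x i • g`, so the quadratic form of `D` at `x`
equals `‖T ξ‖²`, which is nonzero for `x ≠ 0`. -/
theorem posDef_of_injective (hV : IsNestFamily V) {g : G} (hg : ‖g‖ = 1)
    (hVg : ∀ i, V i (adjoint (V i) g) = g) {D : Matrix ι ι ℂ} (hD : D.IsHermitian)
    {T : H →L[ℂ] H} (hT : Function.Injective T)
    (hTD : star T * T = ∑ i, ∑ j, D i j • (adjoint (V i) ∘L V j)) : D.PosDef := by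
  refine Matrix.PosDef.of_dotProduct_mulVec_pos hD fun x hx => ?_
  let ξ : H := ∑ i, x i • adjoint (V i) g
  have hξ : ∀ i, V i ξ = x i • g := by
    intro i
    simp only [ξ, map_sum, map_smul]
    rw [Finset.sum_eq_single i]
    · rw [hVg]
    · intro j _ hj
      rw [hV.apply_adjoint_of_ne hj.symm, smul_zero]
    · simp
  have h1 : ⟪T ξ, T ξ⟫_ℂ = star x ⬝ᵥ D.mulVec x := by
    rw [← adjoint_inner_right]
    have : adjoint T (T ξ) = (star T * T) ξ := rfl
    rw [this, hTD]
    have hgg : ⟪g, g⟫_ℂ = 1 := by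
      rw [inner_self_eq_norm_sq_to_K, hg]; simp
    simp only [sum_apply, smul_apply, inner_sum, inner_smul_right, ContinuousLinearMap.comp_apply,
      adjoint_inner_right, hξ, inner_smul_left, hgg, dotProduct, Matrix.mulVec, Finset.mul_sum]
    refine Finset.sum_congr rfl fun i _ => Finset.sum_congr rfl fun j _ => ?_
    simp
    ring
  have h2 : T ξ ≠ 0 := by
    intro h
    have : ξ = 0 := hT (by rw [h, map_zero])
    refine hx (funext fun i => ?_)
    have h3 := hξ i
    rw [this, map_zero] at h3
    have hg0 : g ≠ 0 := fun h => by simp [h] at hg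
    simpa [hg0] using h3.symm
  rw [← h1]
  exact lt_of_le_of_ne (inner_self_nonneg_complex _) (Ne.symm (inner_self_ne_zero.mpr h2))

/-- The map `X ↦ ∑ i, (V i)* X (V i)` of a nest family is a `C*`-extreme point. -/
theorem isCStarExtreme_of_ne_zero (hV : IsNestFamily V) [Nonempty ι] (h0 : ∀ i, V i ≠ 0) :
    IsCStarExtreme (krausMap V) := by
  refine ⟨⟨isCP_krausMap V, ?_⟩, fun n T ψ hψ hT hsum hφ l => ?_⟩
  · exact hV.sum_adjoint_comp
  obtain ⟨g, hg, hVg⟩ := hV.exists_common_vector h0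
  have hφ' : krausMap V - conjMap (T l) (ψ l) = ∑ i ∈ Finset.univ.erase l, conjMap (T i) (ψ i) := by
    rw [sub_eq_iff_eq_add, Finset.sum_erase_add _ _ (Finset.mem_univ l)]
    ext1 a
    rw [hφ, LinearMap.sum_apply]
    rfl
  obtain ⟨D, hDh, hD⟩ := hV.exists_matrix_of_dominated hg hVg ((hψ l).1.conjMap (T l))
    (hφ' ▸ IsCP.sum _ fun i _ => (hψ i).1.conjMap (T i))
  obtain ⟨t, ht⟩ := hT l
  have hDpos : D.PosDef := by
    refine hV.posDef_of_injective hg hVg hDh (T := T l) ?_ ?_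
    · rw [← ht]
      intro x y hxy
      have : (↑t⁻¹ * (t : H →L[ℂ] H)) x = (↑t⁻¹ * (t : H →L[ℂ] H)) y :=
        congrArg (↑t⁻¹ : H →L[ℂ] H) hxy
      simpa using this
    · have := hD 1
      rw [conjMap_apply, (hψ l).2, mul_one] at this
      exact this
  obtain ⟨S, R, hS, hR, hSR, hRS, hSS⟩ := exists_lower_factor hDpos
  have key : ∀ X, star (T l) * ψ l X * T l
      = star (blockOp V S) * krausMap V X * blockOp V S := by
    intro X
    rw [hV.conj_blockOp hS, hSS, ← hD]
    rfl
  have h1 : blockOp V S * blockOp V R = 1 := by rw [hV.blockOp_mul hR, hSR, hV.blockOp_one]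
  have h2 : blockOp V R * blockOp V S = 1 := by rw [hV.blockOp_mul hS, hRS, hV.blockOp_one]
  have hC : IsUnit (blockOp V S) := ⟨⟨_, _, h1, h2⟩, rfl⟩
  exact unitarilyEquivalent_of_conj (hψ l).2 hV.sum_adjoint_comp (hT l) hC key

/-- Zero members have no common unit vector with the others and are discarded; if nothing remains,
`H = 0`. -/
theorem isCStarExtreme (hV : IsNestFamily V) : IsCStarExtreme (krausMap V) := by
  classical
  have hkraus : krausMap V = krausMap (fun i : {i // V i ≠ 0} => V i) := by
    ext1 X
    rw [krausMap_apply, krausMap_apply,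
      ← Finset.sum_subtype (Finset.univ.filter fun i => V i ≠ 0) (by simp)
        fun i => adjoint (V i) ∘L X ∘L V i]
    refine (Finset.sum_subset (Finset.subset_univ _) fun i _ hi => ?_).symm
    simp [show V i = 0 by simpa using hi]
  by_cases h : Nonempty {i // V i ≠ 0}
  · rw [hkraus]
    exact hV.restrict.isCStarExtreme_of_ne_zero fun i => i.2
  · have h0 : ∀ i, V i = 0 := fun i => by
      by_contra hi
      exact h ⟨i, hi⟩
    have : Subsingleton H := ⟨fun x y => by
      rw [← hV.sum_apply_apply x, ← hV.sum_apply_apply y]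
      simp [h0]⟩
    refine ⟨⟨isCP_krausMap V, hV.sum_adjoint_comp⟩, fun n T ψ _ _ _ _ i => ?_⟩
    exact ⟨LinearIsometryEquiv.refl ℂ H, fun a => Subsingleton.elim _ _⟩

end IsNestFamily

end NestFamily

/-! ### Pure maps with a single Kraus operator -/

section Pure

variable {G : Type*} [NormedAddCommGroup G] [InnerProductSpace ℂ G] [CompleteSpace G]
variable {L : Type*} [NormedAddCommGroup L] [InnerProductSpace ℂ L] [CompleteSpace L]

/-- The map `X ↦ W* X W`. -/
abbrev conjugation (W : L →L[ℂ] G) : (G →L[ℂ] G) →ₗ[ℂ] (L →L[ℂ] L) :=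
  krausMap fun _ : Unit => W

theorem conjugation_apply (W : L →L[ℂ] G) (X : G →L[ℂ] G) :
    conjugation W X = adjoint W ∘L X ∘L W := by
  simp [krausMap_apply]

theorem krausMap_eq_sum {κ : Type*} [Fintype κ] (B : κ → (L →L[ℂ] G)) :
    krausMap B = ∑ k, conjugation (B k) := by
  ext1 X
  simp only [LinearMap.sum_apply, conjugation_apply, krausMap_apply B]

theorem isUCP_conjugation {W : L →L[ℂ] G} (hW : adjoint W ∘L W = 1) : IsUCP (conjugation W) :=
  ⟨isCP_krausMap _, by rw [conjugation_apply]; exact hW⟩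

/-- An isometry is a nest family with one member, so the weight matrix of a dominated map is a
single scalar. -/
theorem isPure_conjugation {W : L →L[ℂ] G} (hW : adjoint W ∘L W = 1) : IsPure (conjugation W) := by
  refine ⟨isCP_krausMap _, fun ψ hψ hφψ => ?_⟩
  rcases subsingleton_or_nontrivial L with hL | hL
  · exact ⟨0, le_rfl, zero_le_one, LinearMap.ext fun X => Subsingleton.elim _ _⟩
  have hV : IsNestFamily (fun _ : Unit => W) := by
    refine ⟨by simpa using hW, fun i j hij => (hij rfl).elim, fun i j _ => ?_⟩
    rw [hW]
    rfl
  have hW0 : W ≠ 0 := by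
    rintro rfl
    rw [comp_zero] at hW
    exact zero_ne_one hW
  obtain ⟨g, hg, hVg⟩ := hV.exists_common_vector fun _ => hW0
  obtain ⟨D, hD, hψD⟩ := hV.exists_matrix_of_dominated hg hVg hψ hφψ
  have hc : (((D () ()).re : ℝ) : ℂ) = D () () :=
    Complex.conj_eq_iff_re.mp (hD.apply () ())
  have hψc : ψ = (((D () ()).re : ℝ) : ℂ) • conjugation W := by
    ext1 X
    rw [hψD, hc, LinearMap.smul_apply, conjugation_apply]
    simp
  obtain ⟨x, hx⟩ := exists_ne (0 : L)
  have hxx : 0 < ‖x‖ ^ 2 := pow_pos (norm_pos_iff.mpr hx) 2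
  have hxx' : ⟪x, x⟫_ℂ = ((‖x‖ ^ 2 : ℝ) : ℂ) := by
    rw [inner_self_eq_norm_sq_to_K]; simp
  have h1 : conjugation W 1 = 1 := (isUCP_conjugation hW).2
  refine ⟨(D () ()).re, ?_, ?_, hψc⟩
  · have h2 := (operator_nonneg_iff _).mp hψ.map_one_nonneg x
    rw [hψc, LinearMap.smul_apply, h1, smul_apply, one_apply_eq_self, inner_smul_right, hxx'] at h2
    have h3 : 0 ≤ (D () ()).re * ‖x‖ ^ 2 := by exact_mod_cast h2
    exact nonneg_of_mul_nonneg_left h3 hxx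
  · have h2 := (operator_nonneg_iff _).mp hφψ.map_one_nonneg x
    rw [hψc, LinearMap.sub_apply, LinearMap.smul_apply, h1, sub_apply, smul_apply,
      one_apply_eq_self, inner_sub_right, inner_smul_right, hxx'] at h2
    have h3 : 0 ≤ ‖x‖ ^ 2 - (D () ()).re * ‖x‖ ^ 2 := by exact_mod_cast h2
    have h4 : 0 ≤ (1 - (D () ()).re) * ‖x‖ ^ 2 := by linarith
    linarith [nonneg_of_mul_nonneg_left h4 hxx]

theorem isNormal_conjugation {G : Type u} [NormedAddCommGroup G] [InnerProductSpace ℂ G]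
    [CompleteSpace G] (W : L →L[ℂ] G) : IsNormal (conjugation W) := by
  intro ι _ _ _ X X₀ _ _ hX h
  simp only [conjugation_apply, ContinuousLinearMap.comp_apply]
  exact ((adjoint W).continuous.tendsto _).comp (hX (W h))

/-- A pure unital map in Kraus form has a single Kraus operator. -/
theorem exists_eq_conjugation {κ : Type*} [Fintype κ] {φ : (G →L[ℂ] G) →ₗ[ℂ] (L →L[ℂ] L)}
    (hφ : IsPure φ) (B : κ → (L →L[ℂ] G)) (hB : φ = krausMap B) :
    ∃ C : L →L[ℂ] G, φ = conjugation C := by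
  classical
  have hsub : ∀ k, ∃ c : ℝ, 0 ≤ c ∧ c ≤ 1 ∧ conjugation (B k) = (c : ℂ) • φ := by
    refine fun k => hφ.2 _ (isCP_krausMap _) ?_
    rw [hB, krausMap_eq_sum, ← Finset.sum_erase_add _ _ (Finset.mem_univ k), add_sub_cancel_right]
    exact IsCP.sum _ fun i _ => isCP_krausMap _
  choose c hc0 hc1 hc using hsub
  by_cases hk : ∃ k, c k ≠ 0
  · obtain ⟨k, hk⟩ := hk
    have hpos : 0 < c k := lt_of_le_of_ne (hc0 k) hk.symm
    -- One Kraus term is `c k • φ` with `c k > 0`; the rescaled operator implements `φ` alone.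
    refine ⟨(((Real.sqrt (c k))⁻¹ : ℝ) : ℂ) • B k, ?_⟩
    have h2 : ((((Real.sqrt (c k))⁻¹ : ℝ) : ℂ) * (((Real.sqrt (c k))⁻¹ : ℝ) : ℂ)) * (c k : ℂ) = 1 := by
      rw [← Complex.ofReal_mul, ← mul_inv, Real.mul_self_sqrt hpos.le, ← Complex.ofReal_mul,
        inv_mul_cancel₀ hk, Complex.ofReal_one]
    ext1 X
    have h3 := DFunLike.congr_fun (hc k) X
    rw [conjugation_apply, LinearMap.smul_apply] at h3
    rw [conjugation_apply, map_smulₛₗ, comp_smul, comp_smul, smul_comp, smul_smul, h3, smul_smul,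
      Complex.conj_ofReal, h2, one_smul]
  · push Not at hk
    have hφ0 : φ = 0 := by
      rw [hB, krausMap_eq_sum]
      exact Finset.sum_eq_zero fun k _ => by rw [hc, hk]; simp
    exact ⟨0, by ext1 X; rw [hφ0, conjugation_apply]; simp⟩

end Pure

/-! ### Nest families and direct sums of pure maps -/

section DirectSum

variable {G : Type*} [NormedAddCommGroup G] [InnerProductSpace ℂ G] [CompleteSpace G]
variable {H : Type*} [NormedAddCommGroup H] [InnerProductSpace ℂ H] [CompleteSpace H]

theorem inner_directSum {A : Type*} [AddCommMonoid A] [Module ℂ A] {n : ℕ} {L : Fin n → Type*}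
    [∀ i, NormedAddCommGroup (L i)] [∀ i, InnerProductSpace ℂ (L i)]
    (φ : ∀ i, A →ₗ[ℂ] (L i →L[ℂ] L i)) (a : A) (x y : PiLp 2 L) :
    ⟪x, directSum φ a y⟫_ℂ = ∑ i, ⟪x i, φ i a (y i)⟫_ℂ := by
  rw [PiLp.inner_apply]
  rfl

/-- A Kraus map which decomposes into pure maps, each a compression of the next one, comes from a
nest family. -/
theorem exists_isNestFamily {κ : Type*} [Fintype κ] (A : κ → (H →L[ℂ] G)) {n : ℕ}
    {L : Fin n → Type*} [∀ i, NormedAddCommGroup (L i)] [∀ i, InnerProductSpace ℂ (L i)]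
    [∀ i, CompleteSpace (L i)] (φ : ∀ i, (G →L[ℂ] G) →ₗ[ℂ] (L i →L[ℂ] L i))
    (h1 : ∀ i, φ i 1 = 1) (hpure : ∀ i, IsPure (φ i))
    (hcomp : ∀ i j : Fin n, (i : ℕ) + 1 = j → IsCompressionOf (φ i) (φ j))
    (hU : UnitarilyEquivalent (krausMap A) (directSum φ)) :
    ∃ V : Fin n → (H →L[ℂ] G), IsNestFamily V ∧ krausMap A = krausMap V := by
  classical
  obtain ⟨U, hU⟩ := hU
  let E : ∀ i, H →L[ℂ] L i := fun i => PiLp.proj 2 L i ∘L (U : H →L[ℂ] PiLp 2 L)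
  have hadj : ∀ i g, adjoint (E i) g = U.symm (adjoint (PiLp.proj (𝕜 := ℂ) 2 L i) g) := by
    intro i g
    simp only [E]
    rw [adjoint_comp, LinearIsometryEquiv.adjoint_eq_symm]
    rfl
  have hE : ∀ i j g, E i (adjoint (E j) g) = PiLp.single 2 j g i := by
    intro i j g
    rw [hadj, proj_adjoint_proj]
    simp [E]
  have hE1 : ∀ i g, E i (adjoint (E i) g) = g := fun i g => by simp [hE]
  have hE0 : ∀ i j, i ≠ j → ∀ g, E i (adjoint (E j) g) = 0 := fun i j hij g => by
    rw [hE]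
    simp [hij]
  have hφ : ∀ X x y, ⟪x, krausMap A X y⟫_ℂ = ∑ i, ⟪E i x, φ i X (E i y)⟫_ℂ := by
    intro X x y
    rw [hU, ContinuousLinearMap.comp_apply, adjoint_inner_right, ContinuousLinearMap.comp_apply,
      inner_directSum]
    rfl
  have hsum : ∀ x y, ⟪x, y⟫_ℂ = ∑ i, ⟪E i x, E i y⟫_ℂ := by
    intro x y
    rw [← U.inner_map_map, PiLp.inner_apply]
    rfl
  -- Compressing to the `i`-th summand keeps the map in Kraus form, as needed to reduce the pure map
  -- `φ i` to one operator.
  have hφi : ∀ i, φ i = krausMap fun k => A k ∘L adjoint (E i) := by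
    intro i
    ext1 X
    ext y
    refine ext_inner_left ℂ fun x => ?_
    have h2 := hφ X (adjoint (E i) x) (adjoint (E i) y)
    rw [Finset.sum_eq_single i, hE1, hE1] at h2
    · rw [← h2, inner_krausMap, inner_krausMap]
      rfl
    · intro j _ hj
      rw [hE0 j i hj, inner_zero_left]
    · simp
  choose B hB using fun i => exists_eq_conjugation (hpure i) _ (hφi i)
  have hB1 : ∀ i x, adjoint (B i) (B i x) = x := by
    intro i x
    have := h1 i
    rw [hB i, conjugation_apply] at this
    exact DFunLike.congr_fun this x
  have hstep : ∀ i j : Fin n, (i : ℕ) + 1 = j → ∀ x, B j (adjoint (B j) (B i x)) = B i x := by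
    intro i j hij x
    obtain ⟨W, hW⟩ := hcomp i j hij
    -- The projection onto the complement of the range of `B j`. It is annihilated by `φ j`, hence
    -- by its compression `φ i`, so `X (B i x) = 0`.
    set X : G →L[ℂ] G := 1 - B j ∘L adjoint (B j) with hX
    have hXB : ∀ y, X (B j y) = 0 := by
      intro y
      simp [hX, hB1]
    have h2 : ⟪x, φ i X x⟫_ℂ = 0 := by
      rw [hW, ContinuousLinearMap.comp_apply, adjoint_inner_right, hB j, conjugation_apply]
      simp [hXB]
    have h3 : ⟪X (B i x), X (B i x)⟫_ℂ = 0 := by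
      rw [← h2, hB i, conjugation_apply, ContinuousLinearMap.comp_apply, adjoint_inner_right,
        ContinuousLinearMap.comp_apply]
      have h4 : X (B i x) = B i x - B j (adjoint (B j) (B i x)) := rfl
      have h5 : adjoint (B j) (X (B i x)) = 0 := by
        rw [h4, map_sub, hB1, sub_self]
      nth_rewrite 1 [h4]
      rw [inner_sub_left, ← adjoint_inner_right (B j), h5, inner_zero_right, sub_zero]
    have h6 := inner_self_eq_zero.mp h3
    exact (sub_eq_zero.mp h6).symm
  have hmono : ∀ i j : Fin n, i ≤ j → ∀ x, B j (adjoint (B j) (B i x)) = B i x := by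
    intro i ⟨j, hj⟩ hij x
    have hij' : (i : ℕ) ≤ j := hij
    induction j, hij' using Nat.le_induction with
    | base => rw [hB1]
    | succ k hk ih =>
      have h2 := ih (Nat.lt_of_succ_lt hj) hk
      rw [← h2, hstep ⟨k, _⟩ ⟨k + 1, hj⟩ rfl]
  refine ⟨fun i => B i ∘L E i, ⟨?_, fun i j hij => ?_, fun i j hij => ?_⟩, ?_⟩
  · ext y
    refine ext_inner_left ℂ fun x => ?_
    simp only [sum_apply, inner_sum, ContinuousLinearMap.comp_apply, adjoint_inner_right,
      one_apply_eq_self]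
    rw [hsum]
    refine Finset.sum_congr rfl fun i _ => ?_
    rw [← adjoint_inner_right (B i), hB1]
  · ext g
    rw [ContinuousLinearMap.comp_apply, adjoint_comp]
    simp [hE0 i j hij]
  · ext x
    simp only [adjoint_comp, ContinuousLinearMap.comp_apply, hE1, hmono i j hij]
  · ext1 X
    ext y
    refine ext_inner_left ℂ fun x => ?_
    rw [hφ, inner_krausMap]
    refine Finset.sum_congr rfl fun i _ => ?_
    rw [hB i, inner_krausMap]
    simp

/-- A map which comes from a nest family decomposes into normal pure maps, each a compression of the
next one. -/
theorem exists_decomposition {G : Type u} [NormedAddCommGroup G] [InnerProductSpace ℂ G]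
    [CompleteSpace G] {n : ℕ} {V : Fin n → (H →L[ℂ] G)} (hV : IsNestFamily V) :
    ∃ (L : Fin n → Type u)
        (_ : ∀ i, NormedAddCommGroup (L i)) (_ : ∀ i, InnerProductSpace ℂ (L i))
        (_ : ∀ i, CompleteSpace (L i))
        (φ : ∀ i, (G →L[ℂ] G) →ₗ[ℂ] (L i →L[ℂ] L i)),
        (∀ i, IsUCP (φ i) ∧ IsPure (φ i) ∧ IsNormal (φ i)) ∧
        (∀ i j : Fin n, (i : ℕ) + 1 = j → IsCompressionOf (φ i) (φ j)) ∧
        UnitarilyEquivalent (krausMap V) (directSum φ) := by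
  classical
  -- The final space of `V i`, written as a kernel so that closedness is immediate.
  let L : Fin n → Submodule ℂ G := fun i => (1 - V i ∘L adjoint (V i)).ker
  have hL : ∀ i g, g ∈ L i ↔ V i (adjoint (V i) g) = g := by
    intro i g
    simp only [L, LinearMap.mem_ker]
    exact sub_eq_zero.trans eq_comm
  have hLc : ∀ i, CompleteSpace (L i) := fun i =>
    (ContinuousLinearMap.isClosed_ker (1 - V i ∘L adjoint (V i))).completeSpace_coe
  have hLV : ∀ i h, V i h ∈ L i := fun i h => by
    rw [hL, hV.apply_adjoint_apply le_rfl]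
  have hiso : ∀ i, adjoint (L i).subtypeL ∘L (L i).subtypeL = 1 := fun i =>
    (L i).subtypeₗᵢ.adjoint_comp_self
  refine ⟨fun i => L i, fun i => inferInstance, fun i => inferInstance, hLc,
    fun i => conjugation (L i).subtypeL, fun i => ⟨isUCP_conjugation (hiso i),
      isPure_conjugation (hiso i), isNormal_conjugation _⟩, fun i j hij => ?_, ?_⟩
  · have hij' : i ≤ j := by
      rw [Fin.le_def]; omega
    have hle : L i ≤ L j := fun g hg => by
      rw [← (hL i g).mp hg, hL, hV.apply_adjoint_apply hij']
    let W : L i →ₗᵢ[ℂ] L j := ⟨Submodule.inclusion hle, fun x => rfl⟩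
    refine ⟨W, fun X => ContinuousLinearMap.ext fun y => ?_⟩
    refine ext_inner_left ℂ fun x => ?_
    simp only [conjugation_apply, ContinuousLinearMap.comp_apply, adjoint_inner_right]
    rfl
  · let f : H →ₗ[ℂ] PiLp 2 (fun i => L i) :=
      { toFun := fun h => WithLp.toLp 2 fun i => ⟨V i h, hLV i h⟩
        map_add' := fun x y => by ext i; simp
        map_smul' := fun c x => by ext i; simp }
    have hf : ∀ h i, ((f h i : L i) : G) = V i h := fun h i => rfl
    have hin : ∀ x y, ⟪f x, f y⟫_ℂ = ⟪x, y⟫_ℂ := by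
      intro x y
      conv_rhs => rw [← hV.sum_apply_apply y, inner_sum]
      rw [PiLp.inner_apply]
      refine Finset.sum_congr rfl fun i _ => ?_
      rw [adjoint_inner_right]
      rfl
    have hs : Function.Surjective (f.isometryOfInner hin) := by
      intro x
      refine ⟨∑ i, adjoint (V i) (x i : G), ?_⟩
      ext j
      change V j (∑ i, adjoint (V i) (x i : G)) = x j
      rw [map_sum, Finset.sum_eq_single j]
      · exact (hL j _).mp (x j).2
      · intro i _ hi
        rw [hV.apply_adjoint_of_ne hi.symm]
      · simp
    refine ⟨LinearIsometryEquiv.ofSurjective _ hs, fun X => ?_⟩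
    ext y
    refine ext_inner_left ℂ fun x => ?_
    rw [ContinuousLinearMap.comp_apply, adjoint_inner_right, ContinuousLinearMap.comp_apply,
      inner_directSum, inner_krausMap]
    refine Finset.sum_congr rfl fun i _ => ?_
    rw [inner_krausMap]
    simp
    rfl

end DirectSum

/-! ### Operator algebras with positive factorization in finite dimension -/

section Factorization

variable {K : Type v} [NormedAddCommGroup K] [InnerProductSpace ℂ K] [FiniteDimensional ℂ K]

/-- Every positive operator factors as `S* S` with `S` in the algebra `M`. -/
def HasFactorization (M : Subalgebra ℂ (K →L[ℂ] K)) : Prop :=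
  ∀ R : K →L[ℂ] K, ∃ S ∈ M, ∀ x y, ⟪S x, S y⟫_ℂ = ⟪R x, R y⟫_ℂ

/-- The subspace `L` is invariant under `M`. -/
def IsInvariant (M : Subalgebra ℂ (K →L[ℂ] K)) (L : Submodule ℂ K) : Prop :=
  ∀ T ∈ M, ∀ x ∈ L, T x ∈ L

variable {M : Subalgebra ℂ (K →L[ℂ] K)}

-- Factor the square of `rankOne ℂ x x`: the factor has kernel `xᗮ`, so it has the form `rankOne ℂ u
-- x`.
omit [FiniteDimensional ℂ K] in
theorem HasFactorization.exists_rankOne_mem (hM : HasFactorization M) {x : K} (hx : x ≠ 0) :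
    ∃ u : K, u ≠ 0 ∧ rankOne ℂ u x ∈ M := by
  obtain ⟨S, hS, hSx⟩ := hM (rankOne ℂ x x)
  have hx' : ⟪x, x⟫_ℂ ≠ 0 := inner_self_ne_zero.mpr hx
  have h1 : S = rankOne ℂ ((⟪x, x⟫_ℂ)⁻¹ • S x) x := by
    ext z
    have h2 : S (z - (⟪x, z⟫_ℂ * (⟪x, x⟫_ℂ)⁻¹) • x) = 0 := by
      rw [← inner_self_eq_zero (𝕜 := ℂ), hSx]
      simp only [map_sub, map_smul, rankOne_apply, smul_smul]
      rw [mul_assoc, inv_mul_cancel₀ hx', mul_one, sub_self, inner_zero_left]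
    rw [map_sub, map_smul, sub_eq_zero] at h2
    rw [h2, rankOne_apply, smul_smul]
  refine ⟨(⟪x, x⟫_ℂ)⁻¹ • S x, ?_, h1 ▸ hS⟩
  refine smul_ne_zero (inv_ne_zero hx') fun h => ?_
  have h3 := hSx x x
  rw [h, inner_zero_left, rankOne_apply, inner_smul_left, inner_smul_right] at h3
  simp [hx] at h3

-- If `x ∈ L` and `y ∈ L'` are nonzero, some `S ∈ M` has kernel exactly the line through `x - y`.
-- Then `S x = S y` lies in both subspaces. Were their intersection zero, `x` would be a multiple of
-- `x - y`, which is impossible.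
omit [FiniteDimensional ℂ K] in
theorem HasFactorization.inf_ne_bot (hM : HasFactorization M) {L L' : Submodule ℂ K}
    (hL : IsInvariant M L) (hL' : IsInvariant M L') (h : L ≠ ⊥) (h' : L' ≠ ⊥) : L ⊓ L' ≠ ⊥ := by
  intro hLL
  obtain ⟨x, hx, hx0⟩ := Submodule.exists_mem_ne_zero_of_ne_bot h
  obtain ⟨y, hy, hy0⟩ := Submodule.exists_mem_ne_zero_of_ne_bot h'
  have hbot : ∀ z ∈ L, z ∈ L' → z = 0 := fun z hz hz' => by
    have : z ∈ L ⊓ L' := ⟨hz, hz'⟩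
    rwa [hLL, Submodule.mem_bot] at this
  set N : Submodule ℂ K := ℂ ∙ (x - y) with hN
  obtain ⟨S, hS, hSR⟩ := hM Nᗮ.starProjection
  have hker : ∀ z, S z = 0 ↔ z ∈ N := by
    intro z
    rw [← inner_self_eq_zero (𝕜 := ℂ), hSR, inner_self_eq_zero,
      Submodule.starProjection_apply_eq_zero_iff, Submodule.orthogonal_orthogonal]
  have h1 : S x = S y := by
    rw [← sub_eq_zero, ← map_sub, hker]
    exact Submodule.mem_span_singleton_self _
  have h2 : S x = 0 := hbot _ (hL S hS x hx) (h1 ▸ hL' S hS y hy)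
  obtain ⟨c, hc⟩ := Submodule.mem_span_singleton.mp ((hker x).mp h2)
  have h3 : (c - 1) • x = c • y := by
    rw [sub_smul, one_smul]
    nth_rewrite 2 [← hc]
    rw [smul_sub]
    abel
  have h4 : (c - 1) • x = 0 := hbot _ (L.smul_mem _ hx) (h3 ▸ L'.smul_mem _ hy)
  have h5 : c = 1 := by
    rcases smul_eq_zero.mp h4 with h | h
    · exact sub_eq_zero.mp h
    · exact (hx0 h).elim
  rw [h4, h5, one_smul] at h3
  exact hy0 h3.symm

/-- A minimal nonzero invariant subspace `L` lies in every nonzero invariant subspace, because any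
two meet. For fixed `x ≠ 0` the `u` with `rankOne ℂ u x ∈ M` form such a subspace, so it contains
`L`. -/
theorem HasFactorization.exists_subspace (hM : HasFactorization M) [Nontrivial K] :
    ∃ L : Submodule ℂ K, L ≠ ⊥ ∧ IsInvariant M L ∧ ∀ u ∈ L, ∀ x, rankOne ℂ u x ∈ M := by
  obtain ⟨L, ⟨hL0, hL⟩, hmin⟩ := WellFounded.has_min (wellFounded_lt (α := Submodule ℂ K))
    {L | L ≠ ⊥ ∧ IsInvariant M L} ⟨⊤, top_ne_bot, fun _ _ _ _ => Submodule.mem_top⟩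
  have hle : ∀ L', L' ≠ ⊥ → IsInvariant M L' → L ≤ L' := by
    intro L' h0 hL'
    by_contra hn
    exact hmin (L ⊓ L') ⟨hM.inf_ne_bot hL hL' hL0 h0,
      fun T hT x hx => ⟨hL T hT x hx.1, hL' T hT x hx.2⟩⟩ (inf_lt_left.mpr hn)
  refine ⟨L, hL0, hL, fun u hu x => ?_⟩
  by_cases hx : x = 0
  · subst hx
    rw [map_zero]
    exact M.zero_mem
  let U : Submodule ℂ K :=
    { carrier := {u | rankOne ℂ u x ∈ M}
      zero_mem' := by simp [M.zero_mem]
      add_mem' := fun {a b} ha hb => by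
        simpa [map_add] using M.add_mem ha hb
      smul_mem' := fun c a ha => by
        simpa [map_smul] using M.smul_mem ha c }
  refine hle U ?_ (fun T hT a ha => ?_) hu
  · obtain ⟨w, hw, hwM⟩ := hM.exists_rankOne_mem hx
    exact fun h => hw ((Submodule.mem_bot ℂ).mp (h ▸ (show w ∈ U from hwM)))
  · have : rankOne ℂ (T a) x = T * rankOne ℂ a x := (comp_rankOne _ _ _).symm
    change rankOne ℂ (T a) x ∈ M
    rw [this]
    exact M.mul_mem hT ha

/-- The compression of an algebra of operators to the orthogonal complement of a subspace whose
projection it contains. -/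
def compressedAlgebra (M : Subalgebra ℂ (K →L[ℂ] K)) (L : Submodule ℂ K)
    (hL : L.starProjection ∈ M) : Subalgebra ℂ (Lᗮ →L[ℂ] Lᗮ) where
  carrier := {T | Lᗮ.subtypeL ∘L T ∘L Lᗮ.orthogonalProjectionOnto ∈ M}
  mul_mem' {a b} ha hb := by
    have := M.mul_mem ha hb
    rw [Set.mem_ofPred_eq]
    convert this using 1
    ext x
    simp
  add_mem' {a b} ha hb := by
    have := M.add_mem ha hb
    rw [Set.mem_ofPred_eq]
    convert this using 1
    ext x
    simp
  algebraMap_mem' c := by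
    have := M.smul_mem (M.sub_mem M.one_mem hL) c
    rw [Set.mem_ofPred_eq]
    rw [← Submodule.starProjection_orthogonal'] at this
    exact this

theorem mem_compressedAlgebra {L : Submodule ℂ K} {hL : L.starProjection ∈ M}
    {T : Lᗮ →L[ℂ] Lᗮ} : T ∈ compressedAlgebra M L hL ↔
      Lᗮ.subtypeL ∘L T ∘L Lᗮ.orthogonalProjectionOnto ∈ M := Iff.rfl

/-- Factor `R* R` extended by the identity on `L`. The factor `S` is isometric on `L` and maps `L`
onto itself by finite dimension; preserving the inner products between `L` and `Lᗮ`, it maps `Lᗮ`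
into `Lᗮ`. So the compression loses nothing. -/
theorem HasFactorization.compressedAlgebra (hM : HasFactorization M) {L : Submodule ℂ K}
    (hL : L.starProjection ∈ M) (hinv : IsInvariant M L) :
    HasFactorization (compressedAlgebra M L hL) := by
  intro R
  obtain ⟨S, hS, hSR⟩ := hM (Lᗮ.subtypeL ∘L R ∘L Lᗮ.orthogonalProjectionOnto + L.starProjection)
  set R' := Lᗮ.subtypeL ∘L R ∘L Lᗮ.orthogonalProjectionOnto + L.starProjection with hR'
  have hR1 : ∀ l ∈ L, R' l = l := by
    intro l hl
    have h1 : Lᗮ.orthogonalProjectionOnto l = 0 := by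
      rw [Submodule.orthogonalProjectionOnto_eq_zero_iff, Submodule.orthogonal_orthogonal]
      exact hl
    simp [hR', h1, Submodule.starProjection_eq_self_iff.mpr hl]
  have hR2 : ∀ x : Lᗮ, R' x = R x := by
    intro x
    have h1 : L.starProjection (x : K) = 0 := L.starProjection_apply_eq_zero_iff.mpr x.2
    simp [hR', h1]
  have hperp : ∀ x : Lᗮ, S x ∈ Lᗮ := by
    intro x
    let f : L →ₗ[ℂ] L := (S : K →ₗ[ℂ] K).restrict fun l hl => hinv S hS l hl
    have hf : Function.Injective f := by
      rw [injective_iff_map_eq_zero]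
      intro l hl
      have h1 : S l = 0 := congrArg Subtype.val hl
      have h2 := hSR l l
      rw [h1, inner_zero_left, hR1 l l.2] at h2
      exact Subtype.ext (inner_self_eq_zero.mp h2.symm)
    rw [Submodule.mem_orthogonal]
    intro u hu
    obtain ⟨l, hl⟩ := LinearMap.injective_iff_surjective.mp hf ⟨u, hu⟩
    have h1 : S l = u := congrArg Subtype.val hl
    rw [← h1, hSR, hR1 l l.2, hR2]
    exact (Submodule.mem_orthogonal L _).mp (R x).2 l l.2
  refine ⟨Lᗮ.orthogonalProjectionOnto ∘L S ∘L Lᗮ.subtypeL, ?_, fun x y => ?_⟩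
  · rw [mem_compressedAlgebra]
    have h1 : (1 - L.starProjection) * S * (1 - L.starProjection) ∈ M :=
      M.mul_mem (M.mul_mem (M.sub_mem M.one_mem hL) hS) (M.sub_mem M.one_mem hL)
    convert h1 using 1
    rw [← Submodule.starProjection_orthogonal']
    rfl
  · have h2 : ∀ x : Lᗮ, ((Lᗮ.orthogonalProjectionOnto (S x) : Lᗮ) : K) = S x := fun x =>
      Submodule.starProjection_eq_self_iff.mpr (hperp x)
    change ⟪((Lᗮ.orthogonalProjectionOnto (S x) : Lᗮ) : K),
      ((Lᗮ.orthogonalProjectionOnto (S y) : Lᗮ) : K)⟫_ℂ = ⟪(R x : K), (R y : K)⟫_ℂ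
    rw [h2, h2, hSR, hR2, hR2]

/-- Split off `L` and recurse on `Lᗮ`; the space is quantified inside because it changes. The level
`r` records the nest. -/
theorem HasFactorization.exists_basis (n : ℕ) : ∀ (K : Type v) [NormedAddCommGroup K]
    [InnerProductSpace ℂ K] [FiniteDimensional ℂ K] (M : Subalgebra ℂ (K →L[ℂ] K)),
    Module.finrank ℂ K = n → HasFactorization M →
    ∃ (ι : Type) (_ : Fintype ι) (b : OrthonormalBasis ι ℂ K) (r : ι → ℕ),
      ∀ i j, r j ≤ r i → rankOne ℂ (b i) (b j) ∈ M := by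
  induction n using Nat.strong_induction_on with
  | _ n ih =>
    intro K _ _ _ M hn hM
    rcases subsingleton_or_nontrivial K with hK | hK
    · refine ⟨_, inferInstance, stdOrthonormalBasis ℂ K, fun _ => 0, fun i j _ => ?_⟩
      rw [Subsingleton.elim (rankOne ℂ _ _) (0 : K →L[ℂ] K)]
      exact M.zero_mem
    obtain ⟨L, hL0, hinv, hLM⟩ := hM.exists_subspace
    let bL := stdOrthonormalBasis ℂ L
    have hL : L.starProjection ∈ M := by
      rw [bL.starProjection_eq_sum_rankOne]
      exact M.sum_mem fun i _ => hLM _ (bL i).2 _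
    have hfin : Module.finrank ℂ Lᗮ < n := by
      have h1 := L.finrank_add_finrank_orthogonal
      have h2 := Submodule.one_le_finrank_iff.mpr hL0
      omega
    obtain ⟨ι, _, b, r, hb⟩ := ih _ hfin Lᗮ _ rfl (hM.compressedAlgebra hL hinv)
    refine ⟨Fin (Module.finrank ℂ L) ⊕ ι, inferInstance,
      (bL.prod b).map L.orthogonalDecomposition.symm,
      -- `L` receives a level strictly above all of `Lᗮ`: operators into `L` are all in `M`, and
      -- none out of `L` into `Lᗮ` are required.
      Sum.elim (fun _ => Finset.univ.sup r + 1) r, ?_⟩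
    have h1 : ∀ i, (bL.prod b).map L.orthogonalDecomposition.symm (Sum.inl i) = bL i := by
      intro i
      simp
    have h2 : ∀ i, (bL.prod b).map L.orthogonalDecomposition.symm (Sum.inr i) = b i := by
      intro i
      simp
    rintro (i | i) j hij
    · rw [h1]
      exact hLM _ (bL i).2 _
    · rcases j with j | j
      · have h3 : r i ≤ Finset.univ.sup r := Finset.le_sup (Finset.mem_univ i)
        simp only [Sum.elim_inl, Sum.elim_inr] at hij
        omega
      · rw [h2, h2]
        have h3 := mem_compressedAlgebra.mp (hb i j hij)
        convert h3 using 1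
        rw [rankOne_comp, Submodule.adjoint_orthogonalProjectionOnto, comp_rankOne]
        rfl

/-- An algebra with factorization contains the triangular operators of an orthonormal basis. -/
theorem HasFactorization.exists_triangular_basis (hM : HasFactorization M) :
    ∃ (n : ℕ) (b : OrthonormalBasis (Fin n) ℂ K), ∀ i j, i ≤ j → rankOne ℂ (b j) (b i) ∈ M := by
  obtain ⟨ι, _, b, r, h⟩ := HasFactorization.exists_basis _ K M rfl hM
  let e := Fintype.equivFin ι
  let σ := Tuple.sort (r ∘ e.symm)
  refine ⟨_, b.reindex (e.trans σ.symm), fun i j hij => ?_⟩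
  rw [OrthonormalBasis.reindex_apply, OrthonormalBasis.reindex_apply]
  exact h _ _ (Tuple.monotone_sort (r ∘ e.symm) hij)

end Factorization

/-- Sending `a s` to `b s` is well defined: a linear relation among the `a s` makes the
corresponding combination of the `b s` have norm zero. -/
theorem exists_map_of_inner {K : Type*} [NormedAddCommGroup K] [InnerProductSpace ℂ K]
    [FiniteDimensional ℂ K] {σ : Type*} (a b : σ → K) (E : K →L[ℂ] K)
    (hab : ∀ s t, ⟪b s, b t⟫_ℂ = ⟪a s, E (a t)⟫_ℂ)
    (ha : Submodule.span ℂ (Set.range a) = ⊤) :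
    ∃ S : K →L[ℂ] K, (∀ s, S (a s) = b s) ∧ ∀ x y, ⟪S x, S y⟫_ℂ = ⟪x, E y⟫_ℂ := by
  let La := Finsupp.linearCombination ℂ a
  let Lb := Finsupp.linearCombination ℂ b
  have hLa : Function.Surjective La := by
    rw [← LinearMap.range_eq_top, Finsupp.range_linearCombination, ha]
  have hL : ∀ c d, ⟪Lb c, Lb d⟫_ℂ = ⟪La c, E (La d)⟫_ℂ := by
    intro c d
    simp only [La, Lb, Finsupp.linearCombination_apply, Finsupp.sum, sum_inner, inner_sum, map_sum,
      map_smul, inner_smul_left, inner_smul_right, hab]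
  have hker : ∀ c, La c = 0 → Lb c = 0 := fun c hc => by
    rw [← inner_self_eq_zero (𝕜 := ℂ), hL, hc, inner_zero_left]
  obtain ⟨r, hr⟩ := La.exists_rightInverse_of_surjective (LinearMap.range_eq_top.mpr hLa)
  have hr' : ∀ x, La (r x) = x := fun x => LinearMap.congr_fun hr x
  have hS : ∀ c, Lb (r (La c)) = Lb c := fun c => by
    rw [← sub_eq_zero, ← map_sub]
    exact hker _ (by rw [map_sub, hr', sub_self])
  refine ⟨LinearMap.toContinuousLinearMap (Lb ∘ₗ r), fun s => ?_, fun x y => ?_⟩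
  · have := hS (Finsupp.single s 1)
    simpa [La, Lb] using this
  · change ⟪Lb (r x), Lb (r y)⟫_ℂ = _
    rw [hL, hr', hr']

section Positivity

variable {E : Type*} [NormedAddCommGroup E] [InnerProductSpace ℂ E]

theorem inner_self_eq_ofReal (x : E) : ⟪x, x⟫_ℂ = ((‖x‖ ^ 2 : ℝ) : ℂ) := by
  rw [inner_self_eq_norm_sq_to_K]
  simp

theorem ofReal_smul_nonneg {c : ℝ} (hc : 0 ≤ c) {T : E →L[ℂ] E} (hT : 0 ≤ T) :
    0 ≤ (c : ℂ) • T := by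
  rw [operator_nonneg_iff] at *
  intro x
  rw [smul_apply, inner_smul_right]
  exact mul_nonneg (by exact_mod_cast hc) (hT x)

theorem one_operator_nonneg : (0 : E →L[ℂ] E) ≤ 1 := by
  rw [operator_nonneg_iff]
  exact inner_self_nonneg_complex

theorem norm_smul_one_sub_nonneg [CompleteSpace E] {T : E →L[ℂ] E} (hT : 0 ≤ T) :
    0 ≤ ((‖T‖ : ℝ) : ℂ) • 1 - T := by
  rw [operator_nonneg_iff] at *
  intro x
  obtain ⟨h1, h2⟩ := Complex.nonneg_iff.mp (hT x)
  have h3 : ⟪x, T x⟫_ℂ = ((⟪x, T x⟫_ℂ).re : ℂ) := Complex.ext rfl (by simp [← h2])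
  rw [sub_apply, inner_sub_right, smul_apply, inner_smul_right, one_apply_eq_self,
    inner_self_eq_ofReal, h3, ← Complex.ofReal_mul, ← Complex.ofReal_sub]
  have h4 : (⟪x, T x⟫_ℂ).re ≤ ‖T‖ * ‖x‖ ^ 2 := by
    calc (⟪x, T x⟫_ℂ).re ≤ ‖⟪x, T x⟫_ℂ‖ := Complex.re_le_norm _
      _ ≤ ‖x‖ * ‖T x‖ := norm_inner_le_norm x (T x)
      _ ≤ ‖x‖ * (‖T‖ * ‖x‖) := by
        gcongr
        exact T.le_opNorm x
      _ = _ := by ring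
  exact_mod_cast sub_nonneg.mpr h4

end Positivity

/-! ### From a `C*`-extreme point to a nest family -/

section Slices

variable {G : Type*} [NormedAddCommGroup G] [InnerProductSpace ℂ G] [CompleteSpace G]
variable {H : Type*} [NormedAddCommGroup H] [InnerProductSpace ℂ H] [CompleteSpace H]
variable {κ : Type*} [Fintype κ]

/-- The slice `(⟨g, A k h⟩)_k`. -/
def slice (A : κ → (H →L[ℂ] G)) (g : G) (h : H) : EuclideanSpace ℂ κ :=
  WithLp.toLp 2 fun k => ⟪g, A k h⟫_ℂ

omit [CompleteSpace G] [CompleteSpace H] [Fintype κ] in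
@[simp]
theorem slice_apply (A : κ → (H →L[ℂ] G)) (g : G) (h : H) (k : κ) :
    slice A g h k = ⟪g, A k h⟫_ℂ := rfl

/-- The operators on the multiplicity space which leave the range of `A` invariant. -/
def sliceAlgebra (A : κ → (H →L[ℂ] G)) :
    Subalgebra ℂ (EuclideanSpace ℂ κ →L[ℂ] EuclideanSpace ℂ κ) where
  carrier := {S | ∀ h, ∃ h', ∀ g, slice A g h' = S (slice A g h)}
  mul_mem' {S R} hS hR h := by
    obtain ⟨h₁, hh₁⟩ := hR h
    obtain ⟨h₂, hh₂⟩ := hS h₁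
    exact ⟨h₂, fun g => by rw [hh₂, hh₁, mul_apply_eq_comp]⟩
  add_mem' {S R} hS hR h := by
    obtain ⟨h₁, hh₁⟩ := hS h
    obtain ⟨h₂, hh₂⟩ := hR h
    refine ⟨h₁ + h₂, fun g => ?_⟩
    rw [add_apply, ← hh₁, ← hh₂]
    ext k
    simp
  algebraMap_mem' c h := by
    refine ⟨c • h, fun g => ?_⟩
    rw [Algebra.algebraMap_eq_smul_one]
    ext k
    simp

variable [DecidableEq κ]

/-- The map `X ↦ ∑ i j, D i j (A i)* X (A j)`. -/
def weightedMap (A : κ → (H →L[ℂ] G)) (D : EuclideanSpace ℂ κ →L[ℂ] EuclideanSpace ℂ κ) :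
    (G →L[ℂ] G) →ₗ[ℂ] (H →L[ℂ] H) where
  toFun X := ∑ i, ∑ j, (D (EuclideanSpace.single j 1) i) • (adjoint (A i) ∘L X ∘L A j)
  map_add' X Y := by simp [Finset.sum_add_distrib]
  map_smul' c X := by simp [Finset.smul_sum, smul_comm c]

variable (A : κ → (H →L[ℂ] G))

theorem weightedMap_apply (D : EuclideanSpace ℂ κ →L[ℂ] EuclideanSpace ℂ κ) (X : G →L[ℂ] G) :
    weightedMap A D X
      = ∑ i, ∑ j, (D (EuclideanSpace.single j 1) i) • (adjoint (A i) ∘L X ∘L A j) := rfl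

theorem weightedMap_add (D E : EuclideanSpace ℂ κ →L[ℂ] EuclideanSpace ℂ κ) :
    weightedMap A (D + E) = weightedMap A D + weightedMap A E := by
  ext1 X
  simp [weightedMap_apply, add_smul, Finset.sum_add_distrib]

theorem weightedMap_smul (c : ℂ) (D : EuclideanSpace ℂ κ →L[ℂ] EuclideanSpace ℂ κ) :
    weightedMap A (c • D) = c • weightedMap A D := by
  ext1 X
  simp [weightedMap_apply, Finset.smul_sum, smul_smul]

theorem weightedMap_one : weightedMap A 1 = krausMap A := by
  ext1 X
  rw [weightedMap_apply, krausMap_apply]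
  refine Finset.sum_congr rfl fun i _ => ?_
  rw [Finset.sum_eq_single i]
  · simp
  · intro j _ hj
    simp [hj.symm]
  · simp

omit [CompleteSpace G] [CompleteSpace H] in
theorem sum_slice (g : G) (h : H) :
    ∑ i, ⟪g, A i h⟫_ℂ • EuclideanSpace.single i (1 : ℂ) = slice A g h := by
  ext k
  simp [WithLp.ofLp_sum, Finset.sum_apply, Pi.single_apply]

/-- On rank one operators the weighted map is the sesquilinear form of `D` evaluated on slices, so
spanning slices determine `D`. -/
theorem inner_weightedMap_rankOne (D : EuclideanSpace ℂ κ →L[ℂ] EuclideanSpace ℂ κ) (g g' : G)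
    (x y : H) :
    ⟪x, weightedMap A D (rankOne ℂ g g') y⟫_ℂ = ⟪slice A g x, D (slice A g' y)⟫_ℂ := by
  rw [← sum_slice A g' y]
  simp only [weightedMap_apply, sum_apply, smul_apply, inner_sum, inner_smul_right, map_sum,
    map_smul, ContinuousLinearMap.comp_apply, adjoint_inner_right, rankOne_apply,
    PiLp.inner_apply, slice_apply, RCLike.inner_apply, inner_conj_symm, Finset.mul_sum]
  rw [Finset.sum_comm]
  refine Finset.sum_congr rfl fun i _ => Finset.sum_congr rfl fun j _ => ?_
  ring

theorem weightedMap_star_mul (R : EuclideanSpace ℂ κ →L[ℂ] EuclideanSpace ℂ κ) :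
    weightedMap A (star R * R)
      = krausMap fun k => ∑ j, (R (EuclideanSpace.single j 1) k) • A j := by
  ext1 X
  ext y
  refine ext_inner_left ℂ fun x => ?_
  have : ∀ i j, (star R * R) (EuclideanSpace.single j 1) i = ∑ k,
      R (EuclideanSpace.single j 1) k *
        (starRingEnd ℂ) (R (EuclideanSpace.single i 1) k) := by
    intro i j
    have h1 : (star R * R) (EuclideanSpace.single j 1) i
        = ⟪EuclideanSpace.single i (1 : ℂ), adjoint R (R (EuclideanSpace.single j 1))⟫_ℂ := by
      rw [EuclideanSpace.inner_single_left]
      simp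
      rfl
    rw [h1, adjoint_inner_right, PiLp.inner_apply]
    rfl
  rw [inner_krausMap]
  simp only [weightedMap_apply, sum_apply, smul_apply, inner_sum, sum_inner, inner_smul_right,
    inner_smul_left, map_sum, map_smul, ContinuousLinearMap.comp_apply, adjoint_inner_right, this,
    Finset.sum_mul, Finset.mul_sum]
  rw [sum_sum_sum_rotate]
  refine Finset.sum_congr rfl fun k _ => ?_
  rw [Finset.sum_comm]
  refine Finset.sum_congr rfl fun i _ => Finset.sum_congr rfl fun j _ => ?_
  ring

theorem isCP_weightedMap {D : EuclideanSpace ℂ κ →L[ℂ] EuclideanSpace ℂ κ} (hD : 0 ≤ D) :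
    IsCP (weightedMap A D) := by
  obtain ⟨R, rfl⟩ := CStarAlgebra.nonneg_iff_eq_star_mul_self.mp hD
  rw [weightedMap_star_mul]
  exact isCP_krausMap _

variable {A}

/-- A weighted map with strictly positive weight is, up to a change of basis, a UCP map. -/
theorem exists_ucp_of_weight (hA : ∑ k, adjoint (A k) ∘L A k = 1)
    {D : EuclideanSpace ℂ κ →L[ℂ] EuclideanSpace ℂ κ} {c : ℝ} (hc : 0 < c)
    (hD : 0 ≤ D - (c : ℂ) • 1) :
    ∃ (T : H →L[ℂ] H) (ψ : (G →L[ℂ] G) →ₗ[ℂ] (H →L[ℂ] H)), IsUnit T ∧ IsUCP ψ ∧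
      star T * T = weightedMap A D 1 ∧ ∀ X, star T * ψ X * T = weightedMap A D X := by
  have h1 : krausMap A 1 = 1 := hA
  have hDc : D = (D - (c : ℂ) • 1) + (c : ℂ) • 1 := by abel
  have hc1 : (0 : EuclideanSpace ℂ κ →L[ℂ] EuclideanSpace ℂ κ) ≤ (c : ℂ) • 1 :=
    ofReal_smul_nonneg hc.le one_operator_nonneg
  have hcp : IsCP (weightedMap A D) := isCP_weightedMap A (by rw [hDc]; exact add_nonneg hD hc1)
  have hQ : (c : ℂ) • (1 : H →L[ℂ] H) ≤ weightedMap A D 1 := by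
    rw [hDc, weightedMap_add, weightedMap_smul, weightedMap_one, LinearMap.add_apply,
      LinearMap.smul_apply, h1]
    exact le_add_of_nonneg_left (isCP_weightedMap A hD).map_one_nonneg
  have hQ0 : 0 ≤ weightedMap A D 1 := hcp.map_one_nonneg
  have hcu : IsStrictlyPositive ((c : ℂ) • (1 : H →L[ℂ] H)) := by
    have hc' : (c : ℂ) ≠ 0 := by exact_mod_cast hc.ne'
    refine ⟨ofReal_smul_nonneg hc.le one_operator_nonneg,
      ⟨⟨(c : ℂ) • 1, (c : ℂ)⁻¹ • 1, ?_, ?_⟩, rfl⟩⟩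
    · rw [smul_mul_smul_comm, mul_inv_cancel₀ hc', one_mul, one_smul]
    · rw [smul_mul_smul_comm, inv_mul_cancel₀ hc', one_mul, one_smul]
  have hQu : IsUnit (weightedMap A D 1) := CStarAlgebra.isUnit_of_le _ hQ hcu
  -- `T` is the positive square root of the value at `1`, invertible because that value dominates
  -- `c`; dividing by it makes the map unital.
  obtain ⟨T, hT⟩ := (CFC.isUnit_sqrt_iff (weightedMap A D 1)).mpr hQu
  have hTs : star (T : H →L[ℂ] H) = T := by
    rw [hT]
    exact (CFC.sqrt_nonneg _).isSelfAdjoint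
  have hTT : (T : H →L[ℂ] H) * T = weightedMap A D 1 := by
    rw [hT]
    exact CFC.sqrt_mul_sqrt_self _ hQ0
  have hTi : star (↑T⁻¹ : H →L[ℂ] H) * T = 1 := by
    have : star (↑T⁻¹ : H →L[ℂ] H) * star (T : H →L[ℂ] H) = 1 := by
      rw [← star_mul, Units.mul_inv, star_one]
    rwa [hTs] at this
  have hTi' : (T : H →L[ℂ] H) * star (↑T⁻¹ : H →L[ℂ] H) = 1 := by
    have : star (T : H →L[ℂ] H) * star (↑T⁻¹ : H →L[ℂ] H) = 1 := by
      rw [← star_mul, Units.inv_mul, star_one]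
    rwa [hTs] at this
  refine ⟨T, conjMap (↑T⁻¹ : H →L[ℂ] H) (weightedMap A D), T.isUnit, ⟨hcp.conjMap _, ?_⟩, ?_,
    fun X => ?_⟩
  · rw [conjMap_apply, ← hTT, ← mul_assoc, hTi, one_mul, Units.mul_inv]
  · rw [hTs, hTT]
  · rw [conjMap_apply, hTs]
    calc (T : H →L[ℂ] H) * (star (↑T⁻¹ : H →L[ℂ] H) * weightedMap A D X * ↑T⁻¹) * T
        = ((T : H →L[ℂ] H) * star (↑T⁻¹ : H →L[ℂ] H)) * weightedMap A D X * (↑T⁻¹ * T) := by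
          simp only [mul_assoc]
      _ = _ := by rw [hTi', Units.inv_mul, one_mul, mul_one]

/-- The weights `t D` and `1 - t D` give a proper `C*`-convex decomposition of `krausMap A`.
Extremality supplies a unitary `U`, and `h ↦ U (T₁ h)` acts on slices by an operator `S` with `S* S
= t D`, which lies in the algebra by construction. -/
theorem exists_factor (hA : ∑ k, adjoint (A k) ∘L A k = 1)
    (hspan : Submodule.span ℂ (Set.range fun p : G × H => slice A p.1 p.2) = ⊤)
    (hext : IsCStarExtreme (krausMap A))
    {D : EuclideanSpace ℂ κ →L[ℂ] EuclideanSpace ℂ κ} {c : ℝ} (hc : 0 < c)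
    (hD : 0 ≤ D - (c : ℂ) • 1) :
    ∃ S ∈ sliceAlgebra A, ∀ x y, ⟪S x, S y⟫_ℂ = ⟪x, D y⟫_ℂ := by
  -- With this value `1 - t D - t = t (‖D‖ - D) ≥ 0`, so the second weight is bounded below by `t`.
  set t : ℝ := (‖D‖ + 1)⁻¹ with ht
  have ht0 : 0 < t := by positivity
  have hD0 : 0 ≤ D := by
    rw [← sub_add_cancel D ((c : ℂ) • 1)]
    exact add_nonneg hD (ofReal_smul_nonneg hc.le one_operator_nonneg)
  have hDn := norm_smul_one_sub_nonneg hD0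
  obtain ⟨T₁, ψ₁, hT₁, hψ₁, hTT₁, hTψ₁⟩ := exists_ucp_of_weight (D := (t : ℂ) • D) hA
    (mul_pos ht0 hc) (by
      have : (t : ℂ) • D - ((t * c : ℝ) : ℂ) • 1 = (t : ℂ) • (D - (c : ℂ) • 1) := by
        rw [smul_sub, smul_smul, Complex.ofReal_mul]
      rw [this]
      exact ofReal_smul_nonneg ht0.le hD)
  obtain ⟨T₂, ψ₂, hT₂, hψ₂, hTT₂, hTψ₂⟩ := exists_ucp_of_weight (D := 1 - (t : ℂ) • D) hA
    ht0 (by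
      have : 1 - (t : ℂ) • D - (t : ℂ) • 1 = (t : ℂ) • (((‖D‖ : ℝ) : ℂ) • 1 - D) := by
        have h1 : (t : ℂ) * (‖D‖ : ℂ) + t = 1 := by
          rw [ht]
          have : ‖D‖ + 1 ≠ 0 := by positivity
          have h2 : (‖D‖ + 1)⁻¹ * ‖D‖ + (‖D‖ + 1)⁻¹ = 1 := by field_simp
          exact_mod_cast h2
        rw [smul_sub, smul_smul, eq_sub_of_add_eq h1]
        module
      rw [this]
      exact ofReal_smul_nonneg ht0.le hDn)
  have hone : weightedMap A ((t : ℂ) • D) + weightedMap A (1 - (t : ℂ) • D) = krausMap A := by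
    rw [← weightedMap_add, ← weightedMap_one]
    congr 1
    abel
  obtain ⟨U, hU⟩ := hext.2 2 ![T₁, T₂] ![ψ₁, ψ₂]
    (fun i => by fin_cases i <;> assumption) (fun i => by fin_cases i <;> assumption)
    (by
      rw [Fin.sum_univ_two]
      simp only [Matrix.cons_val_zero, Matrix.cons_val_one]
      rw [hTT₁, hTT₂, ← LinearMap.add_apply, hone]
      exact hA)
    (fun a => by
      rw [Fin.sum_univ_two]
      simp only [Matrix.cons_val_zero, Matrix.cons_val_one]
      rw [hTψ₁, hTψ₂, ← LinearMap.add_apply, hone]) 0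
  simp only [Matrix.cons_val_zero] at hU
  obtain ⟨S, hS, hSD⟩ := exists_map_of_inner (fun p : G × H => slice A p.1 p.2)
    (fun p : G × H => slice A p.1 (U (T₁ p.2))) ((t : ℂ) • D) (by
      rintro ⟨g, x⟩ ⟨g', y⟩
      rw [← inner_weightedMap_rankOne, ← hTψ₁, hU]
      have := inner_weightedMap_rankOne A 1 g g' (U (T₁ x)) (U (T₁ y))
      rw [weightedMap_one, one_apply_eq_self] at this
      rw [← this]
      simp only [mul_apply_eq_comp, star_eq_adjoint, adjoint_inner_right,
        ContinuousLinearMap.comp_apply]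
      rfl) hspan
  refine ⟨(((Real.sqrt t)⁻¹ : ℝ) : ℂ) • S, Subalgebra.smul_mem _ (fun h => ⟨U (T₁ h), fun g =>
    (hS (g, h)).symm⟩) _, fun x y => ?_⟩
  have h2 : ((((Real.sqrt t)⁻¹ : ℝ) : ℂ) * ((((Real.sqrt t)⁻¹ : ℝ) : ℂ) * (t : ℂ))) = 1 := by
    rw [← mul_assoc, ← Complex.ofReal_mul, ← mul_inv, Real.mul_self_sqrt ht0.le,
      ← Complex.ofReal_mul, inv_mul_cancel₀ ht0.ne', Complex.ofReal_one]
  simp only [smul_apply, inner_smul_left, inner_smul_right, hSD, Complex.conj_ofReal]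
  linear_combination ⟪x, D y⟫_ℂ * h2

/-- Factor `R* R + 1/(n+1)`. The factors are bounded, so a subsequence converges, and its limit
stays in the algebra, which is closed by finite dimension. -/
theorem hasFactorization_sliceAlgebra (hA : ∑ k, adjoint (A k) ∘L A k = 1)
    (hspan : Submodule.span ℂ (Set.range fun p : G × H => slice A p.1 p.2) = ⊤)
    (hext : IsCStarExtreme (krausMap A)) : HasFactorization (sliceAlgebra A) := by
  intro R
  have hseq : ∀ n : ℕ, ∃ S ∈ sliceAlgebra A, ∀ x y, ⟪S x, S y⟫_ℂ
      = ⟪R x, R y⟫_ℂ + ((1 / ((n : ℝ) + 1) : ℝ) : ℂ) * ⟪x, y⟫_ℂ := by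
    intro n
    obtain ⟨S, hS, h⟩ := exists_factor (c := 1 / ((n : ℝ) + 1))
      (D := star R * R + ((1 / ((n : ℝ) + 1) : ℝ) : ℂ) • 1) hA hspan hext (by positivity) (by
        rw [add_sub_cancel_right]
        exact star_mul_self_nonneg R)
    refine ⟨S, hS, fun x y => ?_⟩
    rw [h, add_apply, inner_add_right, smul_apply, inner_smul_right, mul_apply_eq_comp,
      star_eq_adjoint, adjoint_inner_right, one_apply_eq_self]
  choose S hS hSR using hseq
  have hbound : ∀ n, S n ∈ Metric.closedBall
      (0 : EuclideanSpace ℂ κ →L[ℂ] EuclideanSpace ℂ κ) (‖R‖ + 1) := by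
    intro n
    rw [mem_closedBall_zero_iff]
    refine opNorm_le_bound _ (by positivity) fun x => ?_
    have h1 : ‖S n x‖ ^ 2 = ‖R x‖ ^ 2 + 1 / ((n : ℝ) + 1) * ‖x‖ ^ 2 := by
      have := hSR n x x
      simp only [inner_self_eq_ofReal, ← Complex.ofReal_mul, ← Complex.ofReal_add] at this
      exact_mod_cast this
    have h2 : 1 / ((n : ℝ) + 1) ≤ 1 := by
      rw [div_le_one (by positivity)]
      linarith [(Nat.cast_nonneg n : (0 : ℝ) ≤ n)]
    have h3 : ‖R x‖ ≤ ‖R‖ * ‖x‖ := R.le_opNorm x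
    refine le_of_sq_le_sq ?_ (by positivity)
    have h4 : ‖R x‖ ^ 2 ≤ (‖R‖ * ‖x‖) ^ 2 := by gcongr
    have h5 : 1 / ((n : ℝ) + 1) * ‖x‖ ^ 2 ≤ 1 * ‖x‖ ^ 2 := by gcongr
    have h6 : 0 ≤ ‖R‖ * ‖x‖ ^ 2 := by positivity
    nlinarith
  have : ProperSpace (EuclideanSpace ℂ κ →L[ℂ] EuclideanSpace ℂ κ) := FiniteDimensional.proper ℂ _
  obtain ⟨S₀, -, φ, hφ, hlim⟩ := (isCompact_closedBall _ _).tendsto_subseq hbound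
  refine ⟨S₀, ?_, fun x y => ?_⟩
  · have hcl : IsClosed ((Subalgebra.toSubmodule (sliceAlgebra A) : Submodule ℂ _) :
        Set (EuclideanSpace ℂ κ →L[ℂ] EuclideanSpace ℂ κ)) :=
      Submodule.closed_of_finiteDimensional _
    exact hcl.mem_of_tendsto hlim (Filter.Eventually.of_forall fun n => hS (φ n))
  · have hx : ∀ z, Filter.Tendsto (fun n => S (φ n) z) Filter.atTop (𝓝 (S₀ z)) := fun z =>
      ((ContinuousLinearMap.apply ℂ _ z).continuous.tendsto _).comp hlim
    refine tendsto_nhds_unique ((hx x).inner (hx y)) ?_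
    simp only [hSR]
    have h1 := (tendsto_one_div_add_atTop_nhds_zero_nat (𝕜 := ℝ)).comp hφ.tendsto_atTop
    have h2 := (Complex.continuous_ofReal.tendsto 0).comp h1
    have h3 := (h2.mul_const ⟪x, y⟫_ℂ).const_add ⟪R x, R y⟫_ℂ
    simpa [Function.comp_def] using h3

theorem exists_isNestFamily_of_isCStarExtreme (hA : ∑ k, adjoint (A k) ∘L A k = 1)
    (hspan : Submodule.span ℂ (Set.range fun p : G × H => slice A p.1 p.2) = ⊤)
    (hext : IsCStarExtreme (krausMap A)) :
    ∃ (n : ℕ) (V : Fin n → (H →L[ℂ] G)), IsNestFamily V ∧ krausMap A = krausMap V := by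
  obtain ⟨n, b, hb⟩ := (hasFactorization_sliceAlgebra hA hspan hext).exists_triangular_basis
  -- The Kraus operators in the basis `b`; conjugation makes `⟪g, V i h⟫` the `b i`-coordinate of
  -- the slice.
  let V : Fin n → (H →L[ℂ] G) := fun i => ∑ k, (starRingEnd ℂ) (b i k) • A k
  have hV : ∀ i g h, ⟪g, V i h⟫_ℂ = ⟪b i, slice A g h⟫_ℂ := by
    intro i g h
    simp only [V, sum_apply, smul_apply, inner_sum, inner_smul_right, PiLp.inner_apply,
      slice_apply, RCLike.inner_apply]
    exact Finset.sum_congr rfl fun k _ => mul_comm _ _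
  have hkraus : krausMap A = krausMap V := by
    ext1 X
    ext y
    refine ext_inner_left ℂ fun x => ?_
    have h1 : ∀ k l, ∑ i, b i k * (starRingEnd ℂ) (b i l) = if l = k then 1 else 0 := by
      intro k l
      have := b.sum_inner_mul_inner (EuclideanSpace.single k 1) (EuclideanSpace.single l 1)
      simpa [EuclideanSpace.inner_single_left, EuclideanSpace.inner_single_right] using this
    have h2 : ∀ i, ⟪V i x, X (V i y)⟫_ℂ
        = ∑ k, ∑ l, b i k * (starRingEnd ℂ) (b i l) * ⟪A k x, X (A l y)⟫_ℂ := by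
      intro i
      simp only [V, sum_apply, smul_apply, map_sum, map_smul, sum_inner, inner_sum,
        inner_smul_left, inner_smul_right, RCLike.conj_conj, Finset.mul_sum]
      rw [Finset.sum_comm]
      exact Finset.sum_congr rfl fun k _ => Finset.sum_congr rfl fun l _ => by ring
    rw [inner_krausMap, inner_krausMap]
    simp only [h2]
    rw [← sum_sum_sum_rotate]
    simp only [← Finset.sum_mul, h1]
    simp
  have hsum : ∑ i, adjoint (V i) ∘L V i = 1 := by
    have h1 : krausMap V 1 = 1 := by
      rw [← hkraus]
      exact hA
    exact h1
  have hsum' : ∀ h, ∑ i, adjoint (V i) (V i h) = h := by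
    intro h
    have := DFunLike.congr_fun hsum h
    simpa [sum_apply] using this
  -- Invariance under `rankOne ℂ (b j) (b i)` moves the component `V i h` into slot `j` and clears
  -- the others without leaving `H`; the resulting vector is `V j* V i h`. The case `i = j` gives
  -- orthogonality, the general case nestedness.
  have key : ∀ i j, i ≤ j → ∀ m h, V m (adjoint (V j) (V i h)) = if m = j then V i h else 0 := by
    intro i j hij m h
    obtain ⟨h', hh'⟩ := hb i j hij h
    have h1 : ∀ m, V m h' = if m = j then V i h else 0 := by
      intro m
      refine ext_inner_left ℂ fun g => ?_
      rw [hV, hh', rankOne_apply, inner_smul_right, ← hV, b.inner_eq_ite]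
      split_ifs <;> simp
    have h2 : h' = adjoint (V j) (V i h) := by
      rw [← hsum' h', Finset.sum_eq_single j]
      · rw [h1, if_pos rfl]
      · intro k _ hk
        rw [h1, if_neg hk, map_zero]
      · simp
    rw [← h2, h1]
  refine ⟨n, V, ⟨hsum, fun i j hij => ?_, fun i j hij => ?_⟩, hkraus⟩
  · have h1 : ∀ h, V j (adjoint (V i) (V i h)) = 0 := fun h => by
      rw [key i i le_rfl, if_neg hij.symm]
    ext g
    have h2 : adjoint (V i) (V i (adjoint (V j) g)) = 0 := by
      refine ext_inner_right ℂ fun h => ?_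
      rw [adjoint_inner_left, ← adjoint_inner_right, adjoint_inner_left, h1, inner_zero_right,
        inner_zero_left]
    have h3 := key i i le_rfl i (adjoint (V j) g)
    rw [h2, map_zero, if_pos rfl] at h3
    exact h3.symm
  · ext h
    exact (key i j hij j h).trans (if_pos rfl)

end Slices

/-! ### The equivalence for Kraus maps and its transfer to the tensor product -/

section Characterization

variable {G : Type u} [NormedAddCommGroup G] [InnerProductSpace ℂ G] [CompleteSpace G]
variable {H : Type*} [NormedAddCommGroup H] [InnerProductSpace ℂ H] [CompleteSpace H]
variable {κ : Type*} [Fintype κ]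

theorem isCStarExtreme_krausMap_iff (A : κ → (H →L[ℂ] G)) (hA : krausMap A 1 = 1)
    (hspan : Nontrivial G →
      Submodule.span ℂ (Set.range fun p : G × H => slice A p.1 p.2) = ⊤) :
    IsCStarExtreme (krausMap A) ↔
      ∃ (n : ℕ) (L : Fin n → Type u)
        (_ : ∀ i, NormedAddCommGroup (L i)) (_ : ∀ i, InnerProductSpace ℂ (L i))
        (_ : ∀ i, CompleteSpace (L i))
        (φ : ∀ i, (G →L[ℂ] G) →ₗ[ℂ] (L i →L[ℂ] L i)),
        (∀ i, IsUCP (φ i) ∧ IsPure (φ i) ∧ IsNormal (φ i)) ∧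
        (∀ i j : Fin n, (i : ℕ) + 1 = j → IsCompressionOf (φ i) (φ j)) ∧
        UnitarilyEquivalent (krausMap A) (directSum φ) := by
  classical
  constructor
  · intro hext
    obtain ⟨n, V, hV, hAV⟩ : ∃ (n : ℕ) (V : Fin n → (H →L[ℂ] G)),
        IsNestFamily V ∧ krausMap A = krausMap V := by
      -- If `G = 0`, slices vanish and cannot span a nonzero multiplicity space, but then `H = 0`
      -- and the empty family works.
      rcases subsingleton_or_nontrivial G with hG | hG
      · have hH : Subsingleton H := by
          refine subsingleton_of_forall_eq 0 fun h => ?_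
          have h1 := inner_krausMap A 1 h h
          rw [hA, one_apply_eq_self] at h1
          rw [← inner_self_eq_zero (𝕜 := ℂ), h1]
          exact Finset.sum_eq_zero fun k _ => by
            rw [Subsingleton.elim (A k h) 0, inner_zero_left]
        exact ⟨0, fun i => i.elim0, ⟨Subsingleton.elim _ _, fun i => i.elim0, fun i => i.elim0⟩,
          LinearMap.ext fun X => Subsingleton.elim _ _⟩
      · exact exists_isNestFamily_of_isCStarExtreme hA (hspan hG) hext
    rw [hAV]
    exact ⟨n, exists_decomposition hV⟩
  · rintro ⟨n, L, _, _, _, φ, hφ, hcomp, hU⟩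
    obtain ⟨V, hV, hAV⟩ := exists_isNestFamily A φ (fun i => (hφ i).1.2)
      (fun i => (hφ i).2.1) hcomp hU
    rw [hAV]
    exact hV.isCStarExtreme

end Characterization

section Tensor

variable {G : Type u} [NormedAddCommGroup G] [InnerProductSpace ℂ G]
variable {K : Type v} [NormedAddCommGroup K] [InnerProductSpace ℂ K]
variable {κ : Type*} [Fintype κ]

/-- Tensoring with an orthonormal basis is an isometric isomorphism. -/
theorem exists_tensorEquiv (e : OrthonormalBasis κ ℂ K) :
    ∃ F : PiLp 2 (fun _ : κ => G) ≃ₗᵢ[ℂ] G ⊗[ℂ] K, ∀ y, F y = ∑ i, y i ⊗ₜ[ℂ] e i := by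
  classical
  let f : PiLp 2 (fun _ : κ => G) →ₗ[ℂ] G ⊗[ℂ] K :=
    { toFun := fun g => ∑ i, g i ⊗ₜ[ℂ] e i
      map_add' := fun g h => by simp [TensorProduct.add_tmul, Finset.sum_add_distrib]
      map_smul' := fun c g => by simp [TensorProduct.smul_tmul', Finset.smul_sum] }
  have hin : ∀ g h, ⟪f g, f h⟫_ℂ = ⟪g, h⟫_ℂ := by
    intro g h
    simp [f, sum_inner, inner_sum, PiLp.inner_apply, e.inner_eq_ite]
  have hs : Function.Surjective (f.isometryOfInner hin) := by
    intro x
    induction x using TensorProduct.induction_on with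
    | zero => exact ⟨0, map_zero _⟩
    | add x y hx hy =>
      obtain ⟨a, rfl⟩ := hx
      obtain ⟨b, rfl⟩ := hy
      exact ⟨a + b, map_add _ a b⟩
    | tmul g k =>
      refine ⟨WithLp.toLp 2 fun i => e.repr k i • g, ?_⟩
      change ∑ i, (e.repr k i • g) ⊗ₜ[ℂ] e i = g ⊗ₜ[ℂ] k
      conv_rhs => rw [← e.sum_repr k, TensorProduct.tmul_sum]
      simp [TensorProduct.smul_tmul]
  exact ⟨LinearIsometryEquiv.ofSurjective _ hs, fun y => rfl⟩

/-- The compression of `X ↦ X ⊗ 1` in Kraus form. -/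
theorem exists_krausMap_eq [CompleteSpace G] [FiniteDimensional ℂ K]
    (H : Submodule ℂ (G ⊗[ℂ] K)) [CompleteSpace H] :
    ∃ A : Fin (Module.finrank ℂ K) → (H →L[ℂ] G), compressionMap H = krausMap (G := G) (H := H) A ∧
      krausMap (G := G) (H := H) A 1 = 1 ∧ (Nontrivial G → IsMinimalStinespring H →
        Submodule.span ℂ (Set.range fun p : G × H => slice (G := G) (H := H) A p.1 p.2) = ⊤) := by
  have : CompleteSpace (G ⊗[ℂ] K) := completeSpace_tensor
  obtain ⟨F, hF⟩ := exists_tensorEquiv (G := G) (stdOrthonormalBasis ℂ K)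
  let A : Fin (Module.finrank ℂ K) → (H →L[ℂ] G) := fun k =>
    PiLp.proj 2 (fun _ => G) k ∘L (F.symm : G ⊗[ℂ] K →L[ℂ] PiLp 2 (fun _ => G)) ∘L H.subtypeL
  have hA : ∀ k h, A k h = F.symm (h : G ⊗[ℂ] K) k := fun k h => rfl
  have hX : ∀ (X : G →L[ℂ] G) (x : G ⊗[ℂ] K) k,
      F.symm (X.rTensor K x) k = X (F.symm x k) := by
    intro X x k
    obtain ⟨y, rfl⟩ := F.surjective x
    have : X.rTensor K (F y) = F (WithLp.toLp 2 fun i => X (y i)) := by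
      rw [hF, hF, map_sum]
      simp
    rw [this, F.symm_apply_apply, F.symm_apply_apply]
  have hinner : ∀ (X : G →L[ℂ] G) (w : G ⊗[ℂ] K) (y : H),
      ⟪w, X.rTensor K (y : G ⊗[ℂ] K)⟫_ℂ = ∑ k, ⟪F.symm w k, X (A k y)⟫_ℂ := by
    intro X w y
    rw [← F.symm.inner_map_map, PiLp.inner_apply]
    exact Finset.sum_congr rfl fun k _ => by rw [hX, hA]
  have hkraus : compressionMap H = krausMap (G := G) (H := H) A := by
    ext1 X
    refine ContinuousLinearMap.ext fun y => ext_inner_left ℂ fun x => ?_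
    rw [inner_krausMap]
    have : ⟪x, compressionMap H X y⟫_ℂ = ⟪(x : G ⊗[ℂ] K), X.rTensor K (y : G ⊗[ℂ] K)⟫_ℂ :=
      Submodule.inner_orthogonalProjectionOnto_eq_of_mem_left x _
    rw [this, hinner]
    rfl
  refine ⟨A, hkraus, ?_, fun hG hmin => ?_⟩
  · refine ContinuousLinearMap.ext fun y => ext_inner_left ℂ fun x => ?_
    rw [inner_krausMap]
    simp only [one_apply_eq_self, hA]
    rw [Submodule.coe_inner, ← F.symm.inner_map_map, PiLp.inner_apply]
  · rw [IsMinimalStinespring, Submodule.topologicalClosure_eq_top_iff] at hmin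
    rw [← Submodule.orthogonal_eq_bot_iff, Submodule.eq_bot_iff]
    intro v hv
    have hv' : ∀ g h, ⟪slice (G := G) (H := H) A g h, v⟫_ℂ = 0 := fun g h =>
      (Submodule.mem_orthogonal _ v).mp hv _ (Submodule.subset_span ⟨(g, h), rfl⟩)
    obtain ⟨g₀, hg₀⟩ := exists_ne (0 : G)
    -- If `v` is orthogonal to every slice, then `g₀ ⊗ v` is orthogonal to every `(X ⊗ 1) h`, since
    -- pairing with it gives the slice of `h` at `X* g₀`; minimality makes it vanish.
    have hw : F (WithLp.toLp 2 fun k => v k • g₀) = 0 := by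
      rw [← Submodule.mem_bot ℂ, ← hmin, Submodule.mem_orthogonal]
      intro x hx
      induction hx using Submodule.span_induction with
      | mem x hx =>
        obtain ⟨X, h, hh, rfl⟩ := hx
        rw [← inner_conj_symm, hinner X _ ⟨h, hh⟩, F.symm_apply_apply]
        have h1 := hv' (adjoint X g₀) ⟨h, hh⟩
        rw [← inner_conj_symm, PiLp.inner_apply] at h1
        rw [← h1]
        congr 1
        refine Finset.sum_congr rfl fun k _ => ?_
        simp only [inner_smul_left, slice_apply, adjoint_inner_left, RCLike.inner_apply]
        ring
      | zero => exact inner_zero_left _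
      | add x y _ _ hx hy => rw [inner_add_left, hx, hy, add_zero]
      | smul c x _ hx => rw [inner_smul_left, hx, mul_zero]
    have hw' := (map_eq_zero_iff F F.injective).mp hw
    ext k
    have h1 : v k • g₀ = 0 := congrArg (fun z : PiLp 2 (fun _ => G) => z k) hw'
    simpa [hg₀] using h1

end Tensor

/-- `φ` is of the form `X ↦ ∑ k, (A k)* X (A k)`, where `∑ k, (A k)* (A k) = 1` and the slices of
`A` span the multiplicity space. -/
def HasKrausForm {G : Type u} [NormedAddCommGroup G] [InnerProductSpace ℂ G] [CompleteSpace G]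
    {H : Type*} [NormedAddCommGroup H] [InnerProductSpace ℂ H] [CompleteSpace H] (d : ℕ)
    (φ : (G →L[ℂ] G) →ₗ[ℂ] (H →L[ℂ] H)) : Prop :=
  ∃ A : Fin d → (H →L[ℂ] G), φ = krausMap A ∧ krausMap A 1 = 1 ∧
   (Nontrivial G → Submodule.span ℂ (Set.range fun p : G × H => slice A p.1 p.2) = ⊤)

theorem HasKrausForm.isCStarExtreme_iff {G : Type u} [NormedAddCommGroup G]
    [InnerProductSpace ℂ G] [CompleteSpace G]
    {H : Type*} [NormedAddCommGroup H] [InnerProductSpace ℂ H] [CompleteSpace H] {d : ℕ}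
    {φ : (G →L[ℂ] G) →ₗ[ℂ] (H →L[ℂ] H)} (h : HasKrausForm d φ) :
    IsCStarExtreme φ ↔
      ∃ (n : ℕ) (L : Fin n → Type u)
        (_ : ∀ i, NormedAddCommGroup (L i)) (_ : ∀ i, InnerProductSpace ℂ (L i))
        (_ : ∀ i, CompleteSpace (L i))
        (φ' : ∀ i, (G →L[ℂ] G) →ₗ[ℂ] (L i →L[ℂ] L i)),
        (∀ i, IsUCP (φ' i) ∧ IsPure (φ' i) ∧ IsNormal (φ' i)) ∧
        (∀ i j : Fin n, (i : ℕ) + 1 = j → IsCompressionOf (φ' i) (φ' j)) ∧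
        UnitarilyEquivalent φ (directSum φ') := by
  obtain ⟨A, rfl, hA, hs⟩ := h
  exact isCStarExtreme_krausMap_iff A hA hs

theorem hasKrausForm_compressionMap {G : Type u} [NormedAddCommGroup G] [InnerProductSpace ℂ G]
    [CompleteSpace G]
    {K : Type v} [NormedAddCommGroup K] [InnerProductSpace ℂ K] [FiniteDimensional ℂ K]
    (H : Submodule ℂ (G ⊗[ℂ] K)) [CompleteSpace H] (hmin : IsMinimalStinespring H) :
    HasKrausForm (G := G) (H := H) (Module.finrank ℂ K) (compressionMap H) := by
  obtain ⟨A, hkraus, hA, hspan⟩ := exists_krausMap_eq H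
  exact ⟨A, hkraus, hA, fun hG => hspan hG hmin⟩

end CStarExtreme

end

theorem mainTheorem10
    {G : Type u} [NormedAddCommGroup G] [InnerProductSpace ℂ G] [CompleteSpace G]
    [TopologicalSpace.SeparableSpace G]
    {K : Type v} [NormedAddCommGroup K] [InnerProductSpace ℂ K] [FiniteDimensional ℂ K]
    (H : Submodule ℂ (G ⊗[ℂ] K)) [CompleteSpace H]
    (hmin : CStarExtreme.IsMinimalStinespring H) :
    CStarExtreme.IsCStarExtreme (H := H) (CStarExtreme.compressionMap H) ↔
      ∃ (n : ℕ) (L : Fin n → Type u)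
        (_ : ∀ i, NormedAddCommGroup (L i)) (_ : ∀ i, InnerProductSpace ℂ (L i))
        (_ : ∀ i, CompleteSpace (L i))
        (φ : ∀ i, (G →L[ℂ] G) →ₗ[ℂ] (L i →L[ℂ] L i)),
        (∀ i, CStarExtreme.IsUCP (φ i) ∧ CStarExtreme.IsPure (φ i) ∧
          CStarExtreme.IsNormal (φ i)) ∧
        (∀ i j : Fin n, (i : ℕ) + 1 = j → CStarExtreme.IsCompressionOf (φ i) (φ j)) ∧
        CStarExtreme.UnitarilyEquivalent (H₁ := H) (CStarExtreme.compressionMap H)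
          (CStarExtreme.directSum φ) :=
  CStarExtreme.HasKrausForm.isCStarExtreme_iff (G := G) (H := H)
    (CStarExtreme.hasKrausForm_compressionMap H hmin)
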